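/- Let $M$ be a smooth $n$-dimensional manifold, $\mathbf N=TM\setminus\{0\}$ its slit tangent bundle and $\pi:\mathbf N\to M$ the projection. Let $F:TM\to[0,\infty)$ be a Finsler structure: $F$ is smooth on $\mathbf N$, $F(x,\lambda y)=\lambda F(x,y)$ for $\lambda>0$, and the matrix $g_{ij}=\frac12\frac{\partial^2F^2}{\partial y^i\partial y^j}$ is positive definite on $\mathbf N$. In natural coordinates $(x^i,y^i)$ put $$A_{ijk}=\tfrac F2\frac{\partial g_{ij}}{\partial y^k},\quad \gamma^i_{jk}=\tfrac12g^{is}\Big(\frac{\partial g_{sj}}{\partial x^k}-\frac{\partial g_{jk}}{\partial x^s}+\frac{\partial g_{sk}}{\partial x^j}\Big),\quad N^i_j=\gamma^i_{jk}y^k-\tfrac1F g^{il}A_{ljk}\gamma^k_{rs}y^ry^s,$$ $\frac{\delta}{\delta x^j}=\frac{\partial}{\partial x^j}-N^i_j\frac{\partial}{\partial y^i}$ and $G^i=\gamma^i_{sk}y^sy^k$. The horizontal lift of $X\in T_xM$ to $u\in\pi^{-1}(x)$ is $\iota_u(X)=X^j\frac{\delta}{\delta x^j}|_u$. The Chern connection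 $\nabla^{ch}$ and the linear Berwald connection $\nabla^b$ are the linear connections on $\pi^*TM\to\mathbf N$ with connection $1$-forms $\omega^i_k=\Gamma^i_{jk}\,dx^j$, where $$\Gamma^i_{jk}=\tfrac12g^{is}\Big(\frac{\delta g_{sj}}{\delta x^k}-\frac{\delta g_{jk}}{\delta x^s}+\frac{\delta g_{sk}}{\delta x^j}\Big)\ \text{ for }\nabla^{ch},\qquad \Gamma^i_{jk}=\tfrac12\frac{\partial^2G^i}{\partial y^j\partial y^k}\ \text{ for }\nabla^b.$$ The structure is called Berwald if in every chart of $M$ the coefficients $\Gamma^i_{jk}(x,y)$ of $\nabla^{ch}$ depend on $x$ only. For a linear connection $\nabla$ on $\pi^*TM$ the averaged connection $\langle\nabla\rangle$ on $TM$ is $$\langle\nabla\rangle_XY=\frac1{\mathrm{vol}(\mathbf I_x)}\int_{\mathbf I_x}\pi_2\big(\nabla_{\iota_u(X)}\pi^*Y\big)\,dvol(u),\qquad X\in T_xM,$$ where $\pi_2:\pi^*TM\to TM$ is the canonical projection, $\mathbf I_x=\{y\in T_xM: F(x,y)=1\}$ is the indicatrix and $dvol$ is the volume induced on it by the Riemannian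 metric $g_x=g_{ij}(x,y)\,dy^i\otimes dy^j$ of $T_xM\setminus\{0\}$. For a linear connection $D$ on $TM$, the pull-back $\pi^*D$ is the linear connection on $\pi^*TM$ with $(\pi^*D)_{\tilde X}\pi^*Y=D_{d\pi(\tilde X)}Y$ for every $\tilde X\in T_u\mathbf N$ and every vector field $Y$ on $M$. Then: 1. $(M,F)$ is Berwald if and only if $\pi^*\langle\nabla^{ch}\rangle=\nabla^{ch}$. 2. If $\pi^*\langle\nabla^{b}\rangle=\nabla^{b}$, then $(M,F)$ is Berwald. -/

import Mathlib

open Bundle Set MeasureTheory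
open scoped Manifold ContDiff Topology ENNReal

noncomputable section

namespace Finsler

/-! ## The slit tangent bundle `N = TM \ 0` and the pull-back bundle `π*TM → N` -/

/-- The model space of an `n`-dimensional manifold. By Mathlib's definition every tangent space
`T_x M` is a copy of this space, a vector being identified with its components in the preferred
chart at `x`. -/
abbrev E (n : ℕ) : Type := EuclideanSpace ℝ (Fin n)

/-- The `i`-th standard basis vector. -/
abbrev stdVec {n : ℕ} (i : Fin n) : E n := EuclideanSpace.single i (1 : ℝ)

/-- The components of `v ∈ T_x M` in the preferred chart at `x`. -/
def comps {n : ℕ} {M : Type*} [TopologicalSpace M] [ChartedSpace (E n) M] (x : M)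
    (v : TangentSpace (𝓡 n) x) : E n := v

theorem isOpen_slit {n : ℕ} {M : Type*} [TopologicalSpace M] [ChartedSpace (E n) M]
    [IsManifold (𝓡 n) ∞ M] : IsOpen {u : TangentBundle (𝓡 n) M | u.2 ≠ 0} := by
  rw [isOpen_iff_mem_nhds]
  intro u hu
  let e := trivializationAt (E n) (TangentSpace (𝓡 n) : M → Type _) u.1
  have hb : u.1 ∈ e.baseSet := mem_baseSet_trivializationAt _ _ _
  have hs : u ∈ e.source := e.mem_source.2 hb
  have hne : ∀ v ∈ e.source, ((e v).2 ≠ 0 ↔ v.2 ≠ 0) := fun v hv =>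
    not_congr (LinearEquiv.map_eq_zero_iff (e.linearEquivAt ℝ v.1 (e.mem_source.1 hv)))
  have hc : ContinuousAt (fun v => (e v).2) u := (e.continuousAt hs).snd
  filter_upwards [e.open_source.mem_nhds hs, hc.eventually_ne ((hne u hs).2 hu)] with v hv hv0
  exact (hne v hv).1 hv0

/-- The slit tangent bundle `N = TM \ 0`, an open submanifold of `TM`. -/
def Slit (n : ℕ) (M : Type*) [TopologicalSpace M] [ChartedSpace (E n) M]
    [IsManifold (𝓡 n) ∞ M] : TopologicalSpace.Opens (TangentBundle (𝓡 n) M) :=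
  ⟨{u | u.2 ≠ 0}, isOpen_slit⟩

/-- The projection `π : N → M`. -/
def slitProj (n : ℕ) (M : Type*) [TopologicalSpace M] [ChartedSpace (E n) M]
    [IsManifold (𝓡 n) ∞ M] : ContMDiffMap (𝓡 n).tangent (𝓡 n) (Slit n M) M ∞ :=
  ⟨fun u => u.1.1, (contMDiff_proj (TangentSpace (𝓡 n))).comp contMDiff_subtype_val⟩

/-- The pull-back bundle `π*TM → N`; its fibre over `u` is `T_{π u} M`. -/
abbrev PullTM (n : ℕ) (M : Type*) [TopologicalSpace M] [ChartedSpace (E n) M]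
    [IsManifold (𝓡 n) ∞ M] : Slit n M → Type _ :=
  (slitProj n M) *ᵖ (TangentSpace (𝓡 n) : M → Type _)

instance instAddCommGroupPullTM {n : ℕ} {M : Type*} [TopologicalSpace M] [ChartedSpace (E n) M]
    [IsManifold (𝓡 n) ∞ M] (u : Slit n M) : AddCommGroup (PullTM n M u) :=
  inferInstanceAs (AddCommGroup (TangentSpace (𝓡 n) (slitProj n M u)))

instance instIsTopologicalAddGroupPullTM {n : ℕ} {M : Type*} [TopologicalSpace M]
    [ChartedSpace (E n) M] [IsManifold (𝓡 n) ∞ M] (u : Slit n M) :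
    IsTopologicalAddGroup (PullTM n M u) :=
  inferInstanceAs (IsTopologicalAddGroup (TangentSpace (𝓡 n) (slitProj n M u)))

instance instContinuousSMulPullTM {n : ℕ} {M : Type*} [TopologicalSpace M]
    [ChartedSpace (E n) M] [IsManifold (𝓡 n) ∞ M] (u : Slit n M) :
    ContinuousSMul ℝ (PullTM n M u) :=
  inferInstanceAs (ContinuousSMul ℝ (TangentSpace (𝓡 n) (slitProj n M u)))

/-- Linear connections on the bundle `π*TM → N`. For `∇` such a connection, `∇ S u X` is the
covariant derivative at `u : N` of the section `S` in the direction `X ∈ T_u N`. -/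
abbrev PullConnection (n : ℕ) (M : Type*) [TopologicalSpace M] [ChartedSpace (E n) M]
    [IsManifold (𝓡 n) ∞ M] : Type _ :=
  CovariantDerivative (𝓡 n).tangent (E n) (PullTM n M)

/-- The bilinear map with coefficients `c`: `(X, Y) ↦ c^i_{jk} X^j Y^k ∂_i`, as a linear map of
`X`. -/
def coeffMap {n : ℕ} (c : Fin n → Fin n → Fin n → ℝ) (Y : E n) : E n →L[ℝ] E n :=
  LinearMap.toContinuousLinearMap
    { toFun := fun X => WithLp.toLp 2 fun i => ∑ j, ∑ k, c i j k * X j * Y k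
      map_add' := fun X X' => by
        ext i
        simp [mul_add, add_mul, Finset.sum_add_distrib]
      map_smul' := fun a X => by
        ext i
        simp [Finset.mul_sum, mul_assoc, mul_left_comm] }

theorem coeffMap_add {n : ℕ} (c : Fin n → Fin n → Fin n → ℝ) (Y Z X : E n) :
    coeffMap c (Y + Z) X = coeffMap c Y X + coeffMap c Z X := by
  ext i
  simp [coeffMap, mul_add, Finset.sum_add_distrib]

theorem coeffMap_smul {n : ℕ} (c : Fin n → Fin n → Fin n → ℝ) (a : ℝ) (Y X : E n) :
    coeffMap c (a • Y) X = a • coeffMap c Y X := by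
  ext i
  simp [coeffMap, Finset.mul_sum, mul_left_comm]

/-- Over its own base point, the preferred trivialization of `π*TM` at `u` is the identity of
`T_{π u} M`. -/
theorem trivialization_self {n : ℕ} {M : Type*} [TopologicalSpace M] [ChartedSpace (E n) M]
    [IsManifold (𝓡 n) ∞ M] (u : Slit n M) (s : PullTM n M u) :
    (trivializationAt (E n) (PullTM n M) u ⟨u, s⟩).2 = comps u.1.1 s :=
  (tangentBundleCore (𝓡 n) M).coordChange_self (achart (E n) u.1.1) u.1.1
    (mem_achart_source (E n) u.1.1) s

/-- A linear connection on `π*TM → N` is given by its coefficients: the covariant derivative at `u`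
of `S = S^k π*∂_k` in the direction `X ∈ T_u N` is `dS^k(X) ∂_k + Γ^i_{jk}(u) dx^j(X) S^k ∂_i`,
where `∂_i` and `dx^j` belong to the preferred chart at `π u`. -/
def ofCoeff {n : ℕ} {M : Type*} [TopologicalSpace M] [ChartedSpace (E n) M]
    [IsManifold (𝓡 n) ∞ M] (Γ : Slit n M → Fin n → Fin n → Fin n → ℝ) :
    PullConnection n M where
  toFun S u :=
    (mvfderiv (𝓡 n).tangent (fun v => (trivializationAt (E n) (PullTM n M) u ⟨v, S v⟩).2) u :
      TangentSpace (𝓡 n).tangent u →L[ℝ] E n) +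
    coeffMap (Γ u) (comps u.1.1 (S u)) ∘L
      (mfderiv (𝓡 n).tangent (𝓡 n) (slitProj n M) u : TangentSpace (𝓡 n).tangent u →L[ℝ] E n)
  isCovariantDerivativeOnUniv := by
    have key : ∀ (S : ∀ u, PullTM n M u) (u : Slit n M),
        MDifferentiableAt (𝓡 n).tangent ((𝓡 n).tangent.prod 𝓘(ℝ, E n))
          (fun v => (⟨v, S v⟩ : TotalSpace (E n) (PullTM n M))) u →
        MDifferentiableAt (𝓡 n).tangent 𝓘(ℝ, E n)
          (fun v => (trivializationAt (E n) (PullTM n M) u ⟨v, S v⟩).2) u := fun S u hS =>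
      (mdifferentiableAt_section _ S).1 hS
    have hbase : ∀ u : Slit n M, ∀ᶠ v in 𝓝 u,
        v ∈ (trivializationAt (E n) (PullTM n M) u).baseSet := fun u =>
      (trivializationAt (E n) (PullTM n M) u).open_baseSet.mem_nhds
        (mem_baseSet_trivializationAt _ _ _)
    have congr : ∀ (u : Slit n M) (f g : Slit n M → E n), f =ᶠ[𝓝 u] g →
        mvfderiv (𝓡 n).tangent f u = mvfderiv (𝓡 n).tangent g u := by
      intro u f g h
      refine ContinuousLinearMap.ext fun X => ?_
      have := h.mfderiv_eq (I := (𝓡 n).tangent) (I' := 𝓘(ℝ, E n))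
      exact congrArg (fun L : TangentSpace (𝓡 n).tangent u →L[ℝ] E n => L X) this
    refine ⟨?_, ?_⟩
    · intro S S' u hS hS' _
      have h : (fun v => (trivializationAt (E n) (PullTM n M) u ⟨v, (S + S') v⟩).2) =ᶠ[𝓝 u]
          (fun v => (trivializationAt (E n) (PullTM n M) u ⟨v, S v⟩).2) +
            fun v => (trivializationAt (E n) (PullTM n M) u ⟨v, S' v⟩).2 := by
        filter_upwards [hbase u] with v hv
        exact ((trivializationAt (E n) (PullTM n M) u).linear ℝ hv).map_add (S v) (S' v)
      rw [congr u _ _ h, mvfderiv_add (key S u hS) (key S' u hS')]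
      refine ContinuousLinearMap.ext fun X => ?_
      refine Eq.trans ?_ (add_add_add_comm (_ : E n) _ _ _)
      refine congrArg (fun w : E n => _ + w) ?_
      exact coeffMap_add (Γ u) (comps u.1.1 (S u)) (comps u.1.1 (S' u)) _
    · intro S g u hS hg _
      have h : (fun v => (trivializationAt (E n) (PullTM n M) u ⟨v, (g • S) v⟩).2) =ᶠ[𝓝 u]
          g • fun v => (trivializationAt (E n) (PullTM n M) u ⟨v, S v⟩).2 := by
        filter_upwards [hbase u] with v hv
        exact ((trivializationAt (E n) (PullTM n M) u).linear ℝ hv).map_smul (g v) (S v)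
      rw [congr u _ _ h, mvfderiv_smul hg (key S u hS)]
      refine ContinuousLinearMap.ext fun X => ?_
      rw [trivialization_self]
      refine (add_right_comm (_ : E n) _ _).trans ?_
      refine congrArg (fun w : E n => w + _) ?_
      refine Eq.trans ?_ (smul_add (g u) (_ : E n) _).symm
      refine congrArg (fun w : E n => _ + w) ?_
      exact coeffMap_smul (Γ u) (g u) (comps u.1.1 (S u)) _

/-! ## Finsler structures in natural coordinates -/

/-- `∂h/∂x^i` for a function `h` of `(x, y)`. -/
def dX {n : ℕ} (i : Fin n) (h : E n × E n → ℝ) (p : E n × E n) : ℝ :=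
  fderiv ℝ h p (stdVec i, 0)

/-- `∂h/∂y^i` for a function `h` of `(x, y)`. -/
def dY {n : ℕ} (i : Fin n) (h : E n × E n → ℝ) (p : E n × E n) : ℝ :=
  fderiv ℝ h p (0, stdVec i)

/-- The fundamental tensor `g_{ij} = ½ ∂²F²/∂y^i∂y^j` of a function `f(x, y)`. -/
def fundTensor {n : ℕ} (f : E n × E n → ℝ) (p : E n × E n) : Matrix (Fin n) (Fin n) ℝ :=
  Matrix.of fun i j => 1 / 2 * dY i (dY j (fun q => f q ^ 2)) p

/-- The components `A_{ijk} = (F/2) ∂g_{ij}/∂y^k` of the Cartan tensor. -/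
def cartanTensor {n : ℕ} (f : E n × E n → ℝ) (i j k : Fin n) (p : E n × E n) : ℝ :=
  f p / 2 * dY k (fun q => fundTensor f q i j) p

/-- `γ^i_{jk} = ½ g^{is} (∂g_{sj}/∂x^k - ∂g_{jk}/∂x^s + ∂g_{sk}/∂x^j)`. -/
def formalChristoffel {n : ℕ} (f : E n × E n → ℝ) (i j k : Fin n) (p : E n × E n) : ℝ :=
  1 / 2 * ∑ s, (fundTensor f p)⁻¹ i s *
    (dX k (fun q => fundTensor f q s j) p - dX s (fun q => fundTensor f q j k) p +
      dX j (fun q => fundTensor f q s k) p)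

/-- The coefficients of the non-linear connection,
`N^i_j = γ^i_{jk} y^k - A^i_{jk} γ^k_{rs} y^r y^s / F` with `A^i_{jk} = g^{il} A_{ljk}`. -/
def nonlinearCoeff {n : ℕ} (f : E n × E n → ℝ) (i j : Fin n) (p : E n × E n) : ℝ :=
  ∑ k, formalChristoffel f i j k p * p.2 k -
    (∑ k, ∑ r, ∑ s, (∑ l, (fundTensor f p)⁻¹ i l * cartanTensor f l j k p) *
      formalChristoffel f k r s p * p.2 r * p.2 s) / f p

/-- `δh/δx^j = ∂h/∂x^j - N^i_j ∂h/∂y^i`. -/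
def deltaX {n : ℕ} (f : E n × E n → ℝ) (j : Fin n) (h : E n × E n → ℝ) (p : E n × E n) : ℝ :=
  dX j h p - ∑ i, nonlinearCoeff f i j p * dY i h p

/-- The coefficients of the Chern connection,
`Γ^i_{jk} = ½ g^{is} (δg_{sj}/δx^k - δg_{jk}/δx^s + δg_{sk}/δx^j)`: the unique solution of the
structure equations `dx^j ∧ ω^i_j = 0` and `dg_{ij} - g_{kj} ω^k_i - g_{ik} ω^k_j = 2 A_{ijk} δy^k/F`
is `ω^i_k = Γ^i_{jk} dx^j`. -/
def chernCoeff {n : ℕ} (f : E n × E n → ℝ) (i j k : Fin n) (p : E n × E n) : ℝ :=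
  1 / 2 * ∑ s, (fundTensor f p)⁻¹ i s *
    (deltaX f k (fun q => fundTensor f q s j) p - deltaX f s (fun q => fundTensor f q j k) p +
      deltaX f j (fun q => fundTensor f q s k) p)

/-- The spray coefficients `G^i = γ^i_{sk} y^s y^k`. -/
def sprayCoeff {n : ℕ} (f : E n × E n → ℝ) (i : Fin n) (p : E n × E n) : ℝ :=
  ∑ s, ∑ k, formalChristoffel f i s k p * p.2 s * p.2 k

/-- The coefficients `½ ∂²G^i/∂y^j∂y^k` of the linear Berwald connection, that is, the `y`-derivatives
of the coefficients `½ ∂G^i/∂y^j` of the Cartan non-linear connection. -/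
def berwaldCoeff {n : ℕ} (f : E n × E n → ℝ) (i j k : Fin n) (p : E n × E n) : ℝ :=
  1 / 2 * dY k (dY j (sprayCoeff f i)) p

/-- A real function on `TM` in the natural coordinates `(x, y)` induced by the preferred chart
at `x₀`. -/
def coordRep {n : ℕ} {M : Type*} [TopologicalSpace M] [ChartedSpace (E n) M]
    [IsManifold (𝓡 n) ∞ M] (F : TangentBundle (𝓡 n) M → ℝ) (x₀ : M) (p : E n × E n) : ℝ :=
  F ((extChartAt (𝓡 n).tangent (⟨x₀, 0⟩ : TangentBundle (𝓡 n) M)).symm p)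

/-- The natural coordinates, with respect to the preferred chart at `x`, of the vector
`y ∈ T_x M`. -/
def natCoord {n : ℕ} {M : Type*} [TopologicalSpace M] [ChartedSpace (E n) M]
    (x : M) (y : TangentSpace (𝓡 n) x) : E n × E n :=
  (extChartAt (𝓡 n) x x, y)

/-- A Finsler structure on `M`. -/
structure FinslerStructure (n : ℕ) (M : Type*) [TopologicalSpace M] [ChartedSpace (E n) M]
    [IsManifold (𝓡 n) ∞ M] where
  /-- The function `F : TM → [0, ∞)`. -/
  toFun : TangentBundle (𝓡 n) M → ℝ
  nonneg : ∀ u, 0 ≤ toFun u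
  smooth : ContMDiffOn (𝓡 n).tangent 𝓘(ℝ, ℝ) ∞ toFun {u | u.2 ≠ 0}
  homogeneous : ∀ (x : M) (y : TangentSpace (𝓡 n) x) (c : ℝ), 0 < c →
    toFun ⟨x, c • y⟩ = c * toFun ⟨x, y⟩
  /-- Strong convexity: the matrix `(g_{ij}(x, y))` is positive definite for `y ≠ 0`. -/
  convex : ∀ (x : M) (y : TangentSpace (𝓡 n) x), y ≠ 0 →
    (fundTensor (coordRep toFun x) (natCoord x y)).PosDef

section Structure

variable {n : ℕ} {M : Type*} [TopologicalSpace M] [ChartedSpace (E n) M] [IsManifold (𝓡 n) ∞ M]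

/-- The natural coordinates of a point `u` of `N`, with respect to the preferred chart at `π u`. -/
def slitCoord (u : Slit n M) : E n × E n := natCoord u.1.1 u.1.2

/-- The Chern connection `∇^ch`, with connection 1-forms `ω^i_k = Γ^i_{jk} dx^j`. The derivative at
`u` is computed in the preferred chart at `π u`; its value does not depend on the chart. -/
def chernConnection (F : FinslerStructure n M) : PullConnection n M :=
  ofCoeff fun u i j k => chernCoeff (coordRep F.toFun u.1.1) i j k (slitCoord u)

/-- The linear Berwald connection `∇^b`, with connection 1-forms
`ω^i_k = ½ (∂²G^i/∂y^j∂y^k) dx^j`. -/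
def berwaldConnection (F : FinslerStructure n M) : PullConnection n M :=
  ofCoeff fun u i j k => berwaldCoeff (coordRep F.toFun u.1.1) i j k (slitCoord u)

/-- The horizontal lift `ι_u(X) = X^j δ/δx^j = X^j ∂/∂x^j - N^i_j X^j ∂/∂y^i` of `X ∈ T_{π u} M`, in
the natural coordinates at `u`. -/
def horizontalLift (F : FinslerStructure n M) (u : Slit n M) (X : TangentSpace (𝓡 n) u.1.1) :
    TangentSpace (𝓡 n).tangent u :=
  (comps u.1.1 X,
    (-∑ i, ∑ j, (nonlinearCoeff (coordRep F.toFun u.1.1) i j (slitCoord u) * comps u.1.1 X j) •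
      stdVec i : E n))

/-- The section `π*Y` of `π*TM` associated with the vector field `Y`. -/
def pullSection (Y : ∀ x : M, TangentSpace (𝓡 n) x) : ∀ u : Slit n M, PullTM n M u :=
  fun u => Y u.1.1

/-! ## Berwald structures -/

/-- The coordinate vector field `∂_k` of the chart `e`. -/
def coordField (e : OpenPartialHomeomorph M (E n)) (k : Fin n) (x : M) : TangentSpace (𝓡 n) x :=
  mfderiv (𝓡 n) (𝓡 n) e.symm (e x) (stdVec k : E n)

/-- The coefficient `Γ^i_{jk}(u) = dx^i (∇_{ι_u ∂_j} π*∂_k)` in the chart `e` of a connection on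
`π*TM`. -/
def connCoeff (F : FinslerStructure n M) (cov : PullConnection n M)
    (e : OpenPartialHomeomorph M (E n)) (i j k : Fin n) (u : Slit n M) : ℝ :=
  comps (e u.1.1) (mfderiv (𝓡 n) (𝓡 n) e u.1.1 (cov (pullSection (coordField e k)) u
    (horizontalLift F u (coordField e j u.1.1)))) i

/-- A Finsler structure is Berwald if, in every chart, the coefficients of the Chern connection are
functions of `x` alone. -/
def IsBerwald (F : FinslerStructure n M) : Prop :=
  ∀ e ∈ IsManifold.maximalAtlas (𝓡 n) ∞ M, ∀ i j k : Fin n, ∀ u v : Slit n M,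
    u.1.1 ∈ e.source → u.1.1 = v.1.1 →
      connCoeff F (chernConnection F) e i j k u = connCoeff F (chernConnection F) e i j k v

/-! ## The averaged connection -/

/-- The indicatrix `I_x = {y ∈ T_x M | F(x, y) = 1}`; the tangent space is written as its model
space, that is, in the coordinates of the preferred chart at `x`. -/
def indicatrix (F : FinslerStructure n M) (x : M) : Set (E n) :=
  {y | F.toFun ⟨x, y⟩ = 1}

theorem ne_zero_of_mem_indicatrix (F : FinslerStructure n M) {x : M} {y : E n}
    (hy : y ∈ indicatrix F x) : y ≠ 0 := by
  rintro rfl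
  have h := F.homogeneous x 0 2 two_pos
  rw [smul_zero] at h
  have h1 : F.toFun ⟨x, 0⟩ = 1 := hy
  rw [h1] at h
  norm_num at h

/-- A point of `I_x` as a point of `N`. -/
def indicatrixPoint (F : FinslerStructure n M) (x : M) (y : indicatrix F x) : Slit n M :=
  ⟨⟨x, (y : E n)⟩, ne_zero_of_mem_indicatrix F y.2⟩

/-- The Riemannian volume measure `√(det g_{ij}(x, y)) dy` on `T_x M`. -/
def fibreVolume (F : FinslerStructure n M) (x : M) : Measure (E n) :=
  volume.withDensity fun y =>
    ENNReal.ofReal (√(fundTensor (coordRep F.toFun x) (natCoord x y)).det)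

/-- The volume measure that the Riemannian metric `g_x` of `T_x M \ 0` induces on the hypersurface
`I_x`. The position vector field `y` is the `g_x`-unit normal field of `I_x`, so that the induced
volume form is the contraction of the Riemannian volume form `√(det g) dy¹ ∧ ⋯ ∧ dyⁿ` with `y`.
As `g_{ij}(x, y)` is homogeneous of degree `0` in `y`, the corresponding measure of `A ⊆ I_x` is `n`
times the Riemannian volume of the cone `{t a | a ∈ A, 0 < t ≤ 1}`. -/
def indicatrixVolume (F : FinslerStructure n M) (x : M) : Measure (indicatrix F x) :=
  Measure.comap Subtype.val ((n : ℝ≥0∞) •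
    ((fibreVolume F x).restrict {y | 0 < F.toFun ⟨x, y⟩ ∧ F.toFun ⟨x, y⟩ ≤ 1}).map
      fun y : E n => (F.toFun ⟨x, y⟩)⁻¹ • y)

/-- The averaged connection `⟨∇⟩` on `TM`: `averagedConnection F ∇ Y x X` is
`⟨∇⟩_X Y = (1 / vol I_x) ∫_{I_x} π₂ ∇_{ι_u X} π*Y dvol(u)` for `X ∈ T_x M`. -/
def averagedConnection (F : FinslerStructure n M) (cov : PullConnection n M)
    (Y : ∀ x : M, TangentSpace (𝓡 n) x) (x : M) (X : TangentSpace (𝓡 n) x) :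
    TangentSpace (𝓡 n) x :=
  (⨍ y, comps x (cov (pullSection Y) (indicatrixPoint F x y)
    (horizontalLift F (indicatrixPoint F x y) X)) ∂(indicatrixVolume F x) : E n)

/-- The vector field on `M` with constant components `c` in the preferred chart at `x₀` (and `0`
outside the domain of that chart). -/
def constField (x₀ : M) (c : E n) (x : M) : TangentSpace (𝓡 n) x :=
  (trivializationAt (E n) (TangentSpace (𝓡 n) : M → Type _) x₀).symm x c

/-- The pull-back to `π*TM` of a connection `D` on `TM`, given by `(π*D)_X π*Y = D_{dπ X} Y` and the
Leibniz rule: for `S = S^k π*∂_k` near `u`,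
`(π*D)_X S = dS^k(X) ∂_k + S^k(u) D_{dπ X} ∂_k`,
where the `∂_k` are the coordinate fields of the preferred chart at `π u`. -/
def pullbackConnection
    (D : (∀ x : M, TangentSpace (𝓡 n) x) → ∀ x : M, TangentSpace (𝓡 n) x → TangentSpace (𝓡 n) x)
    (S : ∀ u : Slit n M, PullTM n M u) (u : Slit n M) (X : TangentSpace (𝓡 n).tangent u) :
    PullTM n M u :=
  (mvfderiv (𝓡 n).tangent (fun v => (trivializationAt (E n) (PullTM n M) u ⟨v, S v⟩).2) u X +
    ∑ k, comps u.1.1 (S u) k • comps u.1.1 (D (constField u.1.1 (stdVec k)) u.1.1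
      (mfderiv (𝓡 n).tangent (𝓡 n) (slitProj n M) u X)) : E n)

/-- Equality of covariant derivatives on `π*TM`: they agree at every point on every section that is
differentiable there, in every direction. -/
def SameConnection
    (D₁ D₂ : (∀ u : Slit n M, PullTM n M u) → ∀ u : Slit n M,
      TangentSpace (𝓡 n).tangent u → PullTM n M u) : Prop :=
  ∀ (S : ∀ u : Slit n M, PullTM n M u) (u : Slit n M),
    MDifferentiableAt (𝓡 n).tangent ((𝓡 n).tangent.prod 𝓘(ℝ, E n))
      (fun v => (⟨v, S v⟩ : TotalSpace (E n) (PullTM n M))) u →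
    ∀ X : TangentSpace (𝓡 n).tangent u, D₁ S u X = D₂ S u X

end Structure

end Finsler

end

noncomputable section

namespace Finsler

/-! ## Calculus of the partial derivatives `∂/∂x^i` and `∂/∂y^i` -/

section Calculus

variable {n : ℕ} {h k : E n × E n → ℝ} {p : E n × E n}

theorem contDiffAt_fderiv_apply (v : E n × E n) (hh : ContDiffAt ℝ ∞ h p) :
    ContDiffAt ℝ ∞ (fun q => fderiv ℝ h q v) p :=
  (hh.fderiv_right (m := ∞) (by simp)).clm_apply contDiffAt_const

theorem contDiffAt_dX (i : Fin n) (hh : ContDiffAt ℝ ∞ h p) : ContDiffAt ℝ ∞ (dX i h) p :=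
  contDiffAt_fderiv_apply _ hh

theorem contDiffAt_dY (i : Fin n) (hh : ContDiffAt ℝ ∞ h p) : ContDiffAt ℝ ∞ (dY i h) p :=
  contDiffAt_fderiv_apply _ hh

theorem _root_.ContDiffAt.diffAt (hh : ContDiffAt ℝ ∞ h p) : DifferentiableAt ℝ h p :=
  hh.differentiableAt (by simp)

theorem fderiv_apply_comm (v w : E n × E n) (hh : ContDiffAt ℝ ∞ h p) :
    fderiv ℝ (fun q => fderiv ℝ h q v) p w = fderiv ℝ (fun q => fderiv ℝ h q w) p v := by
  have hd : DifferentiableAt ℝ (fderiv ℝ h) p :=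
    (hh.fderiv_right (m := 1) (by norm_cast)).differentiableAt (by simp)
  have hs : IsSymmSndFDerivAt ℝ h p :=
    (hh.of_le (m := 2) (ENat.LEInfty.out)).isSymmSndFDerivAt (by simp)
  rw [fderiv_clm_apply hd (differentiableAt_const v), fderiv_clm_apply hd (differentiableAt_const w)]
  simpa using hs w v

theorem dY_comm (i j : Fin n) (hh : ContDiffAt ℝ ∞ h p) : dY i (dY j h) p = dY j (dY i h) p :=
  fderiv_apply_comm _ _ hh

theorem dY_dX_comm (i j : Fin n) (hh : ContDiffAt ℝ ∞ h p) : dY i (dX j h) p = dX j (dY i h) p :=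
  fderiv_apply_comm _ _ hh

theorem dX_congr (i : Fin n) (e : h =ᶠ[𝓝 p] k) : dX i h p = dX i k p := by
  rw [dX, dX, e.fderiv_eq]

theorem dY_congr (i : Fin n) (e : h =ᶠ[𝓝 p] k) : dY i h p = dY i k p := by
  rw [dY, dY, e.fderiv_eq]

theorem dX_mul (i : Fin n) (hh : ContDiffAt ℝ ∞ h p) (hk : ContDiffAt ℝ ∞ k p) :
    dX i (fun q => h q * k q) p = dX i h p * k p + h p * dX i k p := by
  rw [dX, fderiv_fun_mul hh.diffAt hk.diffAt]
  simp [dX]; ring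

theorem dY_mul (i : Fin n) (hh : ContDiffAt ℝ ∞ h p) (hk : ContDiffAt ℝ ∞ k p) :
    dY i (fun q => h q * k q) p = dY i h p * k p + h p * dY i k p := by
  rw [dY, fderiv_fun_mul hh.diffAt hk.diffAt]
  simp [dY]; ring

theorem dX_const_mul (i : Fin n) (c : ℝ) (hh : ContDiffAt ℝ ∞ h p) :
    dX i (fun q => c * h q) p = c * dX i h p := by
  rw [dX, fderiv_const_mul hh.diffAt]
  simp [dX]

theorem dY_const_mul (i : Fin n) (c : ℝ) (hh : ContDiffAt ℝ ∞ h p) :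
    dY i (fun q => c * h q) p = c * dY i h p := by
  rw [dY, fderiv_const_mul hh.diffAt]
  simp [dY]

theorem dY_sub (i : Fin n) (hh : ContDiffAt ℝ ∞ h p) (hk : ContDiffAt ℝ ∞ k p) :
    dY i (fun q => h q - k q) p = dY i h p - dY i k p := by
  rw [dY, fderiv_fun_sub hh.diffAt hk.diffAt]
  simp [dY]

theorem dY_add (i : Fin n) (hh : ContDiffAt ℝ ∞ h p) (hk : ContDiffAt ℝ ∞ k p) :
    dY i (fun q => h q + k q) p = dY i h p + dY i k p := by
  rw [dY, fderiv_fun_add hh.diffAt hk.diffAt]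
  simp [dY]

theorem dX_sum (i : Fin n) {h : Fin n → E n × E n → ℝ} (hh : ∀ s, ContDiffAt ℝ ∞ (h s) p) :
    dX i (fun q => ∑ s, h s q) p = ∑ s, dX i (h s) p := by
  rw [dX, fderiv_fun_sum fun s _ => (hh s).diffAt]
  simp [dX]

theorem dY_sum (i : Fin n) {h : Fin n → E n × E n → ℝ} (hh : ∀ s, ContDiffAt ℝ ∞ (h s) p) :
    dY i (fun q => ∑ s, h s q) p = ∑ s, dY i (h s) p := by
  rw [dY, fderiv_fun_sum fun s _ => (hh s).diffAt]
  simp [dY]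

theorem contDiffAt_snd_apply (s : Fin n) : ContDiffAt ℝ ∞ (fun q : E n × E n => q.2 s) p :=
  ((EuclideanSpace.proj s : E n →L[ℝ] ℝ).contDiff.comp contDiff_snd).contDiffAt

theorem fderiv_snd_apply (s : Fin n) (v : E n × E n) :
    fderiv ℝ (fun q : E n × E n => q.2 s) p v = v.2 s := by
  have : HasFDerivAt (fun q : E n × E n => q.2 s)
      ((EuclideanSpace.proj s : E n →L[ℝ] ℝ) ∘L ContinuousLinearMap.snd ℝ (E n) (E n)) p :=
    ((EuclideanSpace.proj s : E n →L[ℝ] ℝ) ∘L ContinuousLinearMap.snd ℝ (E n) (E n)).hasFDerivAt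
  rw [this.fderiv]
  rfl

theorem dX_snd_apply (i s : Fin n) : dX i (fun q : E n × E n => q.2 s) p = 0 := by
  rw [dX, fderiv_snd_apply]; simp

theorem dY_snd_apply (i s : Fin n) :
    dY i (fun q : E n × E n => q.2 s) p = if s = i then 1 else 0 := by
  rw [dY, fderiv_snd_apply]; simp

theorem dX_sum_snd_mul (i : Fin n) {h : Fin n → E n × E n → ℝ}
    (hh : ∀ s, ContDiffAt ℝ ∞ (h s) p) :
    dX i (fun q => ∑ s, q.2 s * h s q) p = ∑ s, p.2 s * dX i (h s) p := by
  rw [dX_sum i fun s => (contDiffAt_snd_apply s).mul (hh s)]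
  simp only [dX_mul i (contDiffAt_snd_apply _) (hh _), dX_snd_apply, zero_mul, zero_add]

theorem dY_sum_snd_mul (i : Fin n) {h : Fin n → E n × E n → ℝ}
    (hh : ∀ s, ContDiffAt ℝ ∞ (h s) p) :
    dY i (fun q => ∑ s, q.2 s * h s q) p = h i p + ∑ s, p.2 s * dY i (h s) p := by
  rw [dY_sum i fun s => (contDiffAt_snd_apply s).mul (hh s)]
  simp only [dY_mul i (contDiffAt_snd_apply _) (hh _), dY_snd_apply, Finset.sum_add_distrib]
  simp

theorem fderiv_vertical (v : E n) :
    fderiv ℝ h p (0, v) = ∑ s, v s * dY s h p := by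
  have : ((0 : E n), v) = ∑ s, v s • ((0 : E n), (stdVec s : E n)) := by
    refine Prod.ext ?_ ?_
    · simp [Prod.fst_sum]
    · ext i
      simp [Prod.snd_sum, Pi.single_apply]
  rw [this, map_sum]
  exact Finset.sum_congr rfl fun s _ => map_smul _ _ _

end Calculus

/-! ## The Chern and Berwald coefficients of a homogeneous function -/

theorem contDiffAt_fundTensor {n : ℕ} {f : E n × E n → ℝ} {p : E n × E n}
    (hf : ContDiffAt ℝ ∞ f p) (i j : Fin n) :
    ContDiffAt ℝ ∞ (fun q => fundTensor f q i j) p :=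
  contDiffAt_const.mul (contDiffAt_dY i (contDiffAt_dY j (hf.pow 2)))

theorem contDiffAt_det {n : ℕ} {p : E n × E n} {A : E n × E n → Matrix (Fin n) (Fin n) ℝ}
    (hA : ∀ i j, ContDiffAt ℝ ∞ (fun q => A q i j) p) :
    ContDiffAt ℝ ∞ (fun q => (A q).det) p := by
  simp only [Matrix.det_apply']
  exact ContDiffAt.sum fun σ _ => contDiffAt_const.mul (contDiffAt_prod fun i _ => hA _ _)

/-- `f` is smooth and positively homogeneous in `y` on the open set `W`. -/
structure HomogeneousOn {n : ℕ} (f : E n × E n → ℝ) (W : Set (E n × E n)) : Prop where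
  isOpen : IsOpen W
  smooth : ∀ p ∈ W, ContDiffAt ℝ ∞ f p
  euler : ∀ p ∈ W, fderiv ℝ f p (0, p.2) = f p

namespace HomogeneousOn

variable {n : ℕ} {f : E n × E n → ℝ} {W : Set (E n × E n)} (hW : HomogeneousOn f W)
  {p : E n × E n} (hp : p ∈ W)

include hW

include hp in
theorem sq : ContDiffAt ℝ ∞ (fun q => f q ^ 2) p := (hW.smooth p hp).pow 2

theorem eventually {P : E n × E n → Prop} (hp : p ∈ W) (H : ∀ q ∈ W, P q) : ∀ᶠ q in 𝓝 p, P q :=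
  Filter.mem_of_superset (hW.isOpen.mem_nhds hp) H

include hp

theorem smooth_fundTensor (i j : Fin n) : ContDiffAt ℝ ∞ (fun q => fundTensor f q i j) p :=
  contDiffAt_fundTensor (hW.smooth p hp) i j

theorem fundTensor_symm (i j : Fin n) : fundTensor f p i j = fundTensor f p j i := by
  simp only [fundTensor, Matrix.of_apply]
  rw [dY_comm i j (hW.sq hp)]

theorem dX_fundTensor (k i j : Fin n) :
    dX k (fun q => fundTensor f q i j) p = 1 / 2 * dX k (dY i (dY j fun q => f q ^ 2)) p :=
  dX_const_mul k _ (contDiffAt_dY i (contDiffAt_dY j (hW.sq hp)))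

theorem dY_fundTensor (k i j : Fin n) :
    dY k (fun q => fundTensor f q i j) p = 1 / 2 * dY k (dY i (dY j fun q => f q ^ 2)) p :=
  dY_const_mul k _ (contDiffAt_dY i (contDiffAt_dY j (hW.sq hp)))

theorem dX_fundTensor_symm (k i j : Fin n) :
    dX k (fun q => fundTensor f q i j) p = dX k (fun q => fundTensor f q j i) p :=
  dX_congr k (hW.eventually hp fun _ hq => hW.fundTensor_symm hq i j)

theorem dY_fundTensor_symm (k i j : Fin n) :
    dY k (fun q => fundTensor f q i j) p = dY k (fun q => fundTensor f q j i) p :=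
  dY_congr k (hW.eventually hp fun _ hq => hW.fundTensor_symm hq i j)

theorem dY_fundTensor_comm (k i j : Fin n) :
    dY k (fun q => fundTensor f q i j) p = dY i (fun q => fundTensor f q k j) p := by
  rw [hW.dY_fundTensor hp, hW.dY_fundTensor hp, dY_comm k i (contDiffAt_dY j (hW.sq hp))]

theorem euler_sq : ∑ s, p.2 s * dY s (fun q => f q ^ 2) p = 2 * f p ^ 2 := by
  rw [← fderiv_vertical, fderiv_fun_pow 2 (hW.smooth p hp).diffAt]
  simp [hW.euler p hp]
  ring

theorem euler_dX_sq (i : Fin n) :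
    ∑ s, p.2 s * dX i (dY s fun q => f q ^ 2) p = 2 * dX i (fun q => f q ^ 2) p := by
  rw [← dX_const_mul i 2 (hW.sq hp),
    ← dX_sum_snd_mul i fun s => contDiffAt_dY s (hW.sq hp)]
  exact dX_congr i (hW.eventually hp fun q hq => hW.euler_sq hq)

theorem euler_dY_sq (i : Fin n) :
    ∑ s, p.2 s * dY s (dY i fun q => f q ^ 2) p = dY i (fun q => f q ^ 2) p := by
  have h := dY_congr i (hW.eventually hp fun q hq => hW.euler_sq hq)
  rw [dY_const_mul i 2 (hW.sq hp), dY_sum_snd_mul i fun s => contDiffAt_dY s (hW.sq hp)] at h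
  simp only [dY_comm i _ (hW.sq hp)] at h
  linarith

theorem euler_fundTensor (i : Fin n) :
    ∑ s, p.2 s * fundTensor f p i s = 1 / 2 * dY i (fun q => f q ^ 2) p := by
  rw [← hW.euler_dY_sq hp, Finset.mul_sum]
  refine Finset.sum_congr rfl fun s _ => ?_
  rw [hW.fundTensor_symm hp]
  simp only [fundTensor, Matrix.of_apply]
  ring

theorem euler_dX_fundTensor (k i : Fin n) :
    ∑ s, p.2 s * dX k (fun q => fundTensor f q i s) p =
      1 / 2 * dX k (dY i fun q => f q ^ 2) p := by
  rw [← dX_const_mul k _ (contDiffAt_dY i (hW.sq hp)),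
    ← dX_sum_snd_mul k fun s => hW.smooth_fundTensor hp i s]
  exact dX_congr k (hW.eventually hp fun q hq => hW.euler_fundTensor hq i)

theorem euler_dY_fundTensor (i j : Fin n) :
    ∑ s, p.2 s * dY s (fun q => fundTensor f q i j) p = 0 := by
  have h := dY_congr i (hW.eventually hp fun q hq => hW.euler_fundTensor hq j)
  rw [dY_const_mul i _ (contDiffAt_dY j (hW.sq hp)),
    dY_sum_snd_mul i fun s => hW.smooth_fundTensor hp j s] at h
  have e : fundTensor f p j i = 1 / 2 * dY i (dY j fun q => f q ^ 2) p := by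
    rw [hW.fundTensor_symm hp]; rfl
  rw [e] at h
  rw [← add_eq_left.1 h]
  refine Finset.sum_congr rfl fun s _ => ?_
  rw [hW.dY_fundTensor_comm hp, hW.dY_fundTensor_symm hp]

theorem sum_fundTensor_mul_mul :
    ∑ i, p.2 i * ∑ s, p.2 s * fundTensor f p i s = f p ^ 2 := by
  simp only [hW.euler_fundTensor hp, mul_left_comm _ (1 / 2 : ℝ), ← Finset.mul_sum,
    hW.euler_sq hp]
  ring

end HomogeneousOn

/-- `f` is smooth, positively homogeneous in `y`, nowhere zero and has a non-degenerate fundamental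
tensor on the open set `W`. -/
structure RegularOn {n : ℕ} (f : E n × E n → ℝ) (W : Set (E n × E n)) : Prop
    extends HomogeneousOn f W where
  ne_zero : ∀ p ∈ W, f p ≠ 0
  nondegenerate : ∀ p ∈ W, IsUnit (fundTensor f p).det

namespace RegularOn

variable {n : ℕ} {f : E n × E n → ℝ} {W : Set (E n × E n)} (hW : RegularOn f W)
  {p : E n × E n} (hp : p ∈ W)

include hW hp

theorem fundTensor_mul_inv (v : Fin n → ℝ) (i : Fin n) :
    ∑ m, fundTensor f p i m * ∑ s, (fundTensor f p)⁻¹ m s * v s = v i := by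
  have h : (fundTensor f p).mulVec ((fundTensor f p)⁻¹.mulVec v) = v := by
    rw [Matrix.mulVec_mulVec, Matrix.mul_nonsing_inv _ (hW.nondegenerate p hp), Matrix.one_mulVec]
  exact congrFun h i

theorem fundTensor_injective {v w : Fin n → ℝ}
    (h : ∀ i, ∑ m, fundTensor f p i m * v m = ∑ m, fundTensor f p i m * w m) : v = w :=
  Matrix.mulVec_injective_of_isUnit ((Matrix.isUnit_iff_isUnit_det _).2 (hW.nondegenerate p hp))
    (funext h)

theorem lower_formalChristoffel (m j k : Fin n) :
    ∑ i, fundTensor f p m i * formalChristoffel f i j k p =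
      1 / 2 * (dX k (fun q => fundTensor f q m j) p - dX m (fun q => fundTensor f q j k) p +
        dX j (fun q => fundTensor f q m k) p) := by
  simp only [formalChristoffel]
  rw [← hW.fundTensor_mul_inv hp (fun m => dX k (fun q => fundTensor f q m j) p -
    dX m (fun q => fundTensor f q j k) p + dX j (fun q => fundTensor f q m k) p) m, Finset.mul_sum]
  exact Finset.sum_congr rfl fun i _ => by ring

theorem lower_sprayCoeff (i : Fin n) :
    ∑ l, fundTensor f p i l * sprayCoeff f l p =
      1 / 2 * (∑ k, p.2 k * dX k (dY i fun q => f q ^ 2) p - dX i (fun q => f q ^ 2) p) := by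
  have h1 : ∑ l, fundTensor f p i l * sprayCoeff f l p =
      ∑ s, ∑ k, p.2 s * p.2 k * ∑ l, fundTensor f p i l * formalChristoffel f l s k p := by
    simp only [sprayCoeff, Finset.mul_sum]
    rw [Finset.sum_comm]
    refine Finset.sum_congr rfl fun s _ => ?_
    rw [Finset.sum_comm]
    exact Finset.sum_congr rfl fun k _ => Finset.sum_congr rfl fun l _ => by ring
  have h2 : ∑ s, ∑ k, p.2 s * p.2 k * dX k (fun q => fundTensor f q i s) p =
      1 / 2 * ∑ k, p.2 k * dX k (dY i fun q => f q ^ 2) p := by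
    rw [Finset.sum_comm, Finset.mul_sum]
    refine Finset.sum_congr rfl fun k _ => ?_
    rw [mul_left_comm, ← hW.euler_dX_fundTensor hp, Finset.mul_sum]
    exact Finset.sum_congr rfl fun l _ => by ring
  have h3 : ∑ s, ∑ k, p.2 s * p.2 k * dX i (fun q => fundTensor f q s k) p =
      dX i (fun q => f q ^ 2) p := by
    have h := hW.euler_dX_sq hp i
    have e : ∀ s, dX i (dY s fun q => f q ^ 2) p =
        2 * ∑ k, p.2 k * dX i (fun q => fundTensor f q s k) p := fun s => by
      rw [hW.euler_dX_fundTensor hp]; ring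
    simp only [e] at h
    have : ∑ s, ∑ k, p.2 s * p.2 k * dX i (fun q => fundTensor f q s k) p =
        1 / 2 * ∑ s, p.2 s * (2 * ∑ k, p.2 k * dX i (fun q => fundTensor f q s k) p) := by
      simp only [Finset.mul_sum]
      exact Finset.sum_congr rfl fun k _ => Finset.sum_congr rfl fun l _ => by ring
    rw [this, h]; ring
  have h4 : ∑ s, ∑ k, p.2 s * p.2 k * dX s (fun q => fundTensor f q i k) p =
      1 / 2 * ∑ k, p.2 k * dX k (dY i fun q => f q ^ 2) p := by
    rw [← h2, Finset.sum_comm]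
    exact Finset.sum_congr rfl fun k _ => Finset.sum_congr rfl fun l _ => by ring
  rw [h1]
  simp only [hW.lower_formalChristoffel hp]
  calc _ = 1 / 2 * (∑ s, ∑ k, p.2 s * p.2 k * dX k (fun q => fundTensor f q i s) p
        - ∑ s, ∑ k, p.2 s * p.2 k * dX i (fun q => fundTensor f q s k) p
        + ∑ s, ∑ k, p.2 s * p.2 k * dX s (fun q => fundTensor f q i k) p) := by
        simp only [← Finset.sum_sub_distrib, ← Finset.sum_add_distrib, Finset.mul_sum]
        exact Finset.sum_congr rfl fun k _ => Finset.sum_congr rfl fun l _ => by ring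
    _ = _ := by rw [h2, h3, h4]; ring

theorem lower_nonlinearCoeff (i j : Fin n) :
    ∑ l, fundTensor f p i l * nonlinearCoeff f l j p =
      1 / 2 * ∑ k, p.2 k * dX k (fun q => fundTensor f q i j) p
        - 1 / 4 * dX i (dY j fun q => f q ^ 2) p + 1 / 4 * dX j (dY i fun q => f q ^ 2) p
        - 1 / 2 * ∑ k, dY k (fun q => fundTensor f q i j) p * sprayCoeff f k p := by
  have hN : ∀ l, nonlinearCoeff f l j p = ∑ k, formalChristoffel f l j k p * p.2 k -
      ∑ m, (fundTensor f p)⁻¹ l m *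
        (1 / 2 * ∑ k, dY k (fun q => fundTensor f q m j) p * sprayCoeff f k p) := by
    intro l
    rw [nonlinearCoeff]
    congr 1
    rw [div_eq_iff (hW.ne_zero p hp)]
    calc _ = ∑ k, (∑ m, (fundTensor f p)⁻¹ l m * cartanTensor f m j k p) * sprayCoeff f k p := by
          simp only [sprayCoeff, Finset.mul_sum, mul_assoc]
      _ = _ := by
          simp only [cartanTensor, Finset.sum_mul, Finset.mul_sum]
          rw [Finset.sum_comm]
          exact Finset.sum_congr rfl fun m _ => Finset.sum_congr rfl fun k _ => by ring
  have h1 : ∑ l, fundTensor f p i l * ∑ k, formalChristoffel f l j k p * p.2 k =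
      ∑ k, p.2 k * ∑ l, fundTensor f p i l * formalChristoffel f l j k p := by
    simp only [Finset.mul_sum]
    rw [Finset.sum_comm]
    exact Finset.sum_congr rfl fun k _ => Finset.sum_congr rfl fun l _ => by ring
  simp only [hN, mul_sub, Finset.sum_sub_distrib]
  rw [hW.fundTensor_mul_inv hp
    (fun m => 1 / 2 * ∑ k, dY k (fun q => fundTensor f q m j) p * sprayCoeff f k p), h1]
  simp only [hW.lower_formalChristoffel hp]
  congr 1
  have e1 := hW.euler_dX_fundTensor hp i j
  have e2 := hW.euler_dX_fundTensor hp j i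
  calc _ = 1 / 2 * ∑ k, p.2 k * dX k (fun q => fundTensor f q i j) p
      - 1 / 2 * ∑ k, p.2 k * dX i (fun q => fundTensor f q j k) p
      + 1 / 2 * ∑ k, p.2 k * dX j (fun q => fundTensor f q i k) p := by
        simp only [← Finset.sum_sub_distrib, ← Finset.sum_add_distrib, Finset.mul_sum]
        exact Finset.sum_congr rfl fun k _ => by ring
    _ = _ := by rw [e1, e2]; ring

theorem smooth_inv (i j : Fin n) : ContDiffAt ℝ ∞ (fun q => (fundTensor f q)⁻¹ i j) p := by
  have hadj : ContDiffAt ℝ ∞ (fun q => (fundTensor f q).adjugate i j) p := by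
    simp only [Matrix.adjugate_apply]
    refine contDiffAt_det fun a b => ?_
    by_cases h : a = j
    · subst h
      simpa using contDiffAt_const
    · simpa [Matrix.updateRow_ne h] using hW.smooth_fundTensor hp a b
  simp only [Matrix.inv_def, Ring.inverse_eq_inv', Matrix.smul_apply, smul_eq_mul]
  exact ((contDiffAt_det fun i j => hW.smooth_fundTensor hp i j).inv (hW.nondegenerate p hp).ne_zero).mul
    hadj

theorem smooth_formalChristoffel (i j k : Fin n) :
    ContDiffAt ℝ ∞ (formalChristoffel f i j k) p := by
  unfold formalChristoffel
  exact contDiffAt_const.mul (ContDiffAt.sum fun s _ => (hW.smooth_inv hp i s).mul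
    (((contDiffAt_dX k (hW.smooth_fundTensor hp s j)).sub
      (contDiffAt_dX s (hW.smooth_fundTensor hp j k))).add
        (contDiffAt_dX j (hW.smooth_fundTensor hp s k))))

theorem smooth_sprayCoeff (i : Fin n) : ContDiffAt ℝ ∞ (sprayCoeff f i) p := by
  unfold sprayCoeff
  exact ContDiffAt.sum fun s _ => ContDiffAt.sum fun k _ =>
    ((hW.smooth_formalChristoffel hp i s k).mul (contDiffAt_snd_apply s)).mul
      (contDiffAt_snd_apply k)

/-- The Cartan non-linear connection is the vertical derivative of the spray. -/
theorem nonlinearCoeff_eq (i j : Fin n) :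
    nonlinearCoeff f i j p = 1 / 2 * dY j (sprayCoeff f i) p := by
  revert i
  refine congrFun (hW.fundTensor_injective hp (v := fun i => nonlinearCoeff f i j p)
    (w := fun i => 1 / 2 * dY j (sprayCoeff f i) p) fun i => ?_)
  have h := dY_congr j (hW.eventually hp fun q hq => hW.lower_sprayCoeff hq i)
  rw [dY_sum j fun l => (hW.smooth_fundTensor hp i l).mul (hW.smooth_sprayCoeff hp l),
    dY_const_mul j _ ((ContDiffAt.sum fun k _ => (contDiffAt_snd_apply k).mul
      (contDiffAt_dX k (contDiffAt_dY i (hW.sq hp)))).sub (contDiffAt_dX i (hW.sq hp))),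
    dY_sub j (ContDiffAt.sum fun k _ => (contDiffAt_snd_apply k).mul
      (contDiffAt_dX k (contDiffAt_dY i (hW.sq hp)))) (contDiffAt_dX i (hW.sq hp)),
    dY_sum_snd_mul j fun k => contDiffAt_dX k (contDiffAt_dY i (hW.sq hp))] at h
  simp only [dY_mul j (hW.smooth_fundTensor hp i _) (hW.smooth_sprayCoeff hp _),
    Finset.sum_add_distrib, dY_dX_comm j _ (contDiffAt_dY i (hW.sq hp)),
    dY_dX_comm j _ (hW.sq hp)] at h
  have e1 : ∀ k, dX k (dY j (dY i fun q => f q ^ 2)) p =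
      2 * dX k (fun q => fundTensor f q i j) p := fun k => by
    rw [hW.dX_fundTensor_symm hp, hW.dX_fundTensor hp]; ring
  have e2 : ∀ k, dY j (fun q => fundTensor f q i k) p = dY k (fun q => fundTensor f q i j) p :=
    fun k => by
      rw [hW.dY_fundTensor_symm hp, hW.dY_fundTensor_comm hp, hW.dY_fundTensor_symm hp]
  simp only [e1, e2, mul_left_comm _ (2 : ℝ), ← Finset.mul_sum] at h
  rw [hW.lower_nonlinearCoeff hp]
  simp only [mul_left_comm _ (1 / 2 : ℝ), ← Finset.mul_sum]
  linarith

/-- `F²` is constant along horizontal curves. -/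
theorem dX_sq_eq (j : Fin n) :
    dX j (fun q => f q ^ 2) p = ∑ s, nonlinearCoeff f s j p * dY s (fun q => f q ^ 2) p := by
  have h1 : ∑ s, nonlinearCoeff f s j p * dY s (fun q => f q ^ 2) p =
      2 * ∑ m, p.2 m * ∑ s, fundTensor f p m s * nonlinearCoeff f s j p := by
    have e : ∀ s, dY s (fun q => f q ^ 2) p = 2 * ∑ m, p.2 m * fundTensor f p m s := fun s => by
      simp only [fun m => hW.fundTensor_symm hp m s]
      rw [hW.euler_fundTensor hp]; ring
    simp only [e, Finset.mul_sum]
    rw [Finset.sum_comm]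
    exact Finset.sum_congr rfl fun k _ => Finset.sum_congr rfl fun l _ => by ring
  have h2 : ∑ m, p.2 m * ∑ k, p.2 k * dX k (fun q => fundTensor f q m j) p =
      1 / 2 * ∑ k, p.2 k * dX k (dY j fun q => f q ^ 2) p := by
    simp only [Finset.mul_sum]
    rw [Finset.sum_comm]
    refine Finset.sum_congr rfl fun k _ => ?_
    rw [mul_left_comm, ← hW.euler_dX_fundTensor hp, Finset.mul_sum]
    exact Finset.sum_congr rfl fun l _ => by rw [hW.dX_fundTensor_symm hp]; ring
  have h3 : ∑ m, p.2 m * ∑ k, dY k (fun q => fundTensor f q m j) p * sprayCoeff f k p = 0 := by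
    simp only [Finset.mul_sum]
    rw [Finset.sum_comm]
    refine Finset.sum_eq_zero fun k _ => ?_
    simp only [← mul_assoc, ← Finset.sum_mul]
    rw [← zero_mul (sprayCoeff f k p), ← hW.euler_dY_fundTensor hp k j]
    congr 1
    exact Finset.sum_congr rfl fun l _ => by rw [hW.dY_fundTensor_comm hp]
  rw [h1]
  simp only [hW.lower_nonlinearCoeff hp, mul_sub, mul_add, Finset.sum_sub_distrib,
    Finset.sum_add_distrib, mul_left_comm _ (1 / 2 : ℝ), mul_left_comm _ (1 / 4 : ℝ)]
  simp only [← Finset.mul_sum, h2, h3, hW.euler_dX_sq hp]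
  ring

theorem smooth_nonlinearCoeff (i j : Fin n) : ContDiffAt ℝ ∞ (nonlinearCoeff f i j) p :=
  (contDiffAt_const.mul (contDiffAt_dY j (hW.smooth_sprayCoeff hp i))).congr_of_eventuallyEq
    (hW.eventually hp fun _ hq => hW.nonlinearCoeff_eq hq i j)

theorem smooth_berwaldCoeff (i j k : Fin n) : ContDiffAt ℝ ∞ (berwaldCoeff f i j k) p :=
  contDiffAt_const.mul (contDiffAt_dY k (contDiffAt_dY j (hW.smooth_sprayCoeff hp i)))

theorem dY_nonlinearCoeff (i j k : Fin n) :
    dY k (nonlinearCoeff f i j) p = berwaldCoeff f i j k p := by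
  rw [dY_congr k (hW.eventually hp fun _ hq => hW.nonlinearCoeff_eq hq i j),
    dY_const_mul k _ (contDiffAt_dY j (hW.smooth_sprayCoeff hp i)), berwaldCoeff]

theorem berwaldCoeff_symm (i j k : Fin n) : berwaldCoeff f i j k p = berwaldCoeff f i k j p := by
  rw [berwaldCoeff, berwaldCoeff, dY_comm _ _ (hW.smooth_sprayCoeff hp i)]

theorem dY_dX_sq (j k : Fin n) :
    dY k (dX j fun q => f q ^ 2) p = ∑ s, (berwaldCoeff f s j k p * dY s (fun q => f q ^ 2) p +
      nonlinearCoeff f s j p * dY k (dY s fun q => f q ^ 2) p) := by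
  rw [dY_congr k (hW.eventually hp fun q hq => hW.dX_sq_eq hq j),
    dY_sum k fun s => (hW.smooth_nonlinearCoeff hp s j).mul (contDiffAt_dY s (hW.sq hp))]
  simp only [dY_mul k (hW.smooth_nonlinearCoeff hp _ j) (contDiffAt_dY _ (hW.sq hp)),
    hW.dY_nonlinearCoeff hp]

/-- If the Berwald coefficients are vertically constant, the Berwald connection is horizontally
metric. -/
theorem deltaX_fundTensor (h : ∀ i j k l, dY l (berwaldCoeff f i j k) p = 0) (i j k : Fin n) :
    deltaX f j (fun q => fundTensor f q i k) p =
      ∑ s, fundTensor f p i s * berwaldCoeff f s j k p +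
        ∑ s, fundTensor f p k s * berwaldCoeff f s j i p := by
  have H := dY_congr i (hW.eventually hp fun q hq => hW.dY_dX_sq hq j k)
  have s1 := fun s => (hW.smooth_berwaldCoeff hp s j k).mul (contDiffAt_dY s (hW.sq hp))
  have s2 := fun s => (hW.smooth_nonlinearCoeff hp s j).mul
    (contDiffAt_dY k (contDiffAt_dY s (hW.sq hp)))
  have e0 : dY i (dY k (dX j fun q => f q ^ 2)) p = 2 * dX j (fun q => fundTensor f q i k) p := by
    rw [dY_congr i (hW.eventually hp fun _ hq => dY_dX_comm k j (hW.sq hq)),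
      dY_dX_comm i j (contDiffAt_dY k (hW.sq hp)), hW.dX_fundTensor hp]
    ring
  rw [e0, dY_sum i fun s => (s1 s).add (s2 s)] at H
  have e1 : ∀ s, dY i (dY k (dY s fun q => f q ^ 2)) p =
      2 * dY s (fun q => fundTensor f q i k) p := fun s => by
    rw [hW.dY_fundTensor_comm hp, hW.dY_fundTensor_symm hp, hW.dY_fundTensor hp]; ring
  have e2 : ∀ a b, dY a (dY b fun q => f q ^ 2) p = 2 * fundTensor f p a b := fun a b => by
    simp only [fundTensor, Matrix.of_apply]; ring
  simp only [dY_add i (s1 _) (s2 _),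
    dY_mul i (hW.smooth_berwaldCoeff hp _ j k) (contDiffAt_dY _ (hW.sq hp)),
    dY_mul i (hW.smooth_nonlinearCoeff hp _ j) (contDiffAt_dY k (contDiffAt_dY _ (hW.sq hp))),
    hW.dY_nonlinearCoeff hp, h, zero_mul, zero_add, e1, e2] at H
  have : ∑ s, (berwaldCoeff f s j k p * (2 * fundTensor f p i s) +
      (berwaldCoeff f s j i p * (2 * fundTensor f p k s) +
        nonlinearCoeff f s j p * (2 * dY s (fun q => fundTensor f q i k) p))) =
      2 * (∑ s, fundTensor f p i s * berwaldCoeff f s j k p +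
        ∑ s, fundTensor f p k s * berwaldCoeff f s j i p +
        ∑ s, nonlinearCoeff f s j p * dY s (fun q => fundTensor f q i k) p) := by
    rw [← Finset.sum_add_distrib, ← Finset.sum_add_distrib, Finset.mul_sum]
    exact Finset.sum_congr rfl fun s _ => by ring
  rw [this] at H
  rw [deltaX]
  linarith

theorem chernCoeff_eq_berwaldCoeff (h : ∀ i j k l, dY l (berwaldCoeff f i j k) p = 0)
    (i j k : Fin n) : chernCoeff f i j k p = berwaldCoeff f i j k p := by
  revert i
  refine congrFun (hW.fundTensor_injective hp (v := fun i => chernCoeff f i j k p)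
    (w := fun i => berwaldCoeff f i j k p) fun i => ?_)
  simp only [chernCoeff, mul_left_comm _ (1 / 2 : ℝ), ← Finset.mul_sum]
  rw [hW.fundTensor_mul_inv hp (fun m => deltaX f k (fun q => fundTensor f q m j) p -
    deltaX f m (fun q => fundTensor f q j k) p + deltaX f j (fun q => fundTensor f q m k) p)]
  simp only [hW.deltaX_fundTensor hp h, hW.berwaldCoeff_symm hp _ k j,
    hW.berwaldCoeff_symm hp _ k i, hW.berwaldCoeff_symm hp _ j i]
  ring

end RegularOn

/-! ## Homogeneity of the fundamental tensor -/

theorem dY_scale {n : ℕ} {h : E n × E n → ℝ} {p : E n × E n} {c a : ℝ}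
    (hp : DifferentiableAt ℝ h p) (hc : DifferentiableAt ℝ h (p.1, c • p.2))
    (e : ∀ᶠ q in 𝓝 p, h (q.1, c • q.2) = a * h q) (i : Fin n) :
    c * dY i h (p.1, c • p.2) = a * dY i h p := by
  let S : E n × E n →L[ℝ] E n × E n :=
    (ContinuousLinearMap.fst ℝ _ _).prod (c • ContinuousLinearMap.snd ℝ _ _)
  have h1 : HasFDerivAt (fun q => h (S q)) (fderiv ℝ h (p.1, c • p.2) ∘L S) p :=
    HasFDerivAt.comp p (f := S) hc.hasFDerivAt S.hasFDerivAt
  have h2 : HasFDerivAt (fun q => h (S q)) (a • fderiv ℝ h p) p :=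
    (hp.hasFDerivAt.const_mul a).congr_of_eventuallyEq e
  have h3 : fderiv ℝ h (p.1, c • p.2) (S (0, stdVec i)) = a * fderiv ℝ h p (0, stdVec i) :=
    congrArg (fun T => T ((0 : E n), (stdVec i : E n))) (h1.unique h2)
  have h4 : S (0, stdVec i) = c • ((0 : E n), (stdVec i : E n)) := by simp [S]
  rwa [h4, map_smul] at h3

/-- The fundamental tensor of a function homogeneous of degree `1` is homogeneous of degree `0`. -/
theorem fundTensor_scale {n : ℕ} {f : E n × E n → ℝ} {V : Set (E n × E n)} (hV : IsOpen V)
    (hf : ∀ p ∈ V, ContDiffAt ℝ ∞ f p) {c : ℝ} (hc : c ≠ 0)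
    (hcV : ∀ p ∈ V, (p.1, c • p.2) ∈ V) (hhom : ∀ p ∈ V, f (p.1, c • p.2) = c * f p)
    {p : E n × E n} (hp : p ∈ V) : fundTensor f (p.1, c • p.2) = fundTensor f p := by
  have h1 : ∀ j, ∀ q ∈ V, dY j (fun q => f q ^ 2) (q.1, c • q.2) =
      c * dY j (fun q => f q ^ 2) q := by
    intro j q hq
    have := dY_scale (c := c) (a := c ^ 2) ((hf q hq).pow 2).diffAt
      ((hf _ (hcV q hq)).pow 2).diffAt
      (Filter.mem_of_superset (hV.mem_nhds hq) fun r hr => by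
        change f _ ^ 2 = _
        rw [hhom r hr, mul_pow]) j
    exact mul_left_cancel₀ hc (by rw [this]; ring)
  ext i j
  have := dY_scale (contDiffAt_dY j ((hf p hp).pow 2)).diffAt
    (contDiffAt_dY j ((hf _ (hcV p hp)).pow 2)).diffAt
    (Filter.mem_of_superset (hV.mem_nhds hp) (h1 j)) i
  simp only [fundTensor, Matrix.of_apply]
  rw [mul_left_cancel₀ hc this]

theorem fderiv_euler {n : ℕ} {f : E n × E n → ℝ} {p : E n × E n} (hf : DifferentiableAt ℝ f p)
    (h : ∀ c : ℝ, 0 < c → f (p.1, c • p.2) = c * f p) : fderiv ℝ f p (0, p.2) = f p := by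
  have h1 : HasDerivAt (fun c : ℝ => (p.1, c • p.2)) ((0 : E n), p.2) 1 := by
    refine (hasDerivAt_const (1 : ℝ) p.1).prodMk ?_
    simpa using (hasDerivAt_id (1 : ℝ)).smul_const p.2
  have hf' : HasFDerivAt f (fderiv ℝ f p) (p.1, (1 : ℝ) • p.2) := by
    rw [one_smul]; exact hf.hasFDerivAt
  have h2 := hf'.comp_hasDerivAt (1 : ℝ) h1
  have h3 : HasDerivAt (fun c : ℝ => c * f p) (f p) 1 := by
    simpa using (hasDerivAt_id (1 : ℝ)).mul_const (f p)
  refine h2.unique (h3.congr_of_eventuallyEq ?_)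
  filter_upwards [lt_mem_nhds one_pos] with c hc using h c hc

/-- A function that is constant along a punctured fibre has vanishing vertical derivatives. -/
theorem dY_eq_zero_of_const {n : ℕ} {h : E n × E n → ℝ} {x y : E n} {a : ℝ} (hy : y ≠ 0)
    (hd : DifferentiableAt ℝ h (x, y)) (hc : ∀ z : E n, z ≠ 0 → h (x, z) = a) (i : Fin n) :
    dY i h (x, y) = 0 := by
  have h1 : HasFDerivAt (fun z : E n => h (x, z))
      (fderiv ℝ h (x, y) ∘L ContinuousLinearMap.inr ℝ (E n) (E n)) y :=
    HasFDerivAt.comp y hd.hasFDerivAt (hasFDerivAt_prodMk_right x y)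
  have h2 : HasFDerivAt (fun z : E n => h (x, z)) (0 : E n →L[ℝ] ℝ) y := by
    refine (hasFDerivAt_const a y).congr_of_eventuallyEq ?_
    filter_upwards [isOpen_ne.mem_nhds hy] with z hz using hc z hz
  have h3 := congrArg (fun T => T (stdVec i : E n)) (h1.unique h2)
  simpa [dY] using h3

/-! ## Finsler structures in the preferred charts -/

section Structure

variable {n : ℕ} {M : Type*} [TopologicalSpace M] [ChartedSpace (E n) M] [IsManifold (𝓡 n) ∞ M]

theorem mem_target_tangent (x : M) (p : E n × E n) :
    p ∈ (extChartAt (𝓡 n).tangent (⟨x, 0⟩ : TangentBundle (𝓡 n) M)).target ↔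
      p.1 ∈ (extChartAt (𝓡 n) x).target := by
  rw [FiberBundle.extChartAt_target]
  simp only [mem_prod, mem_univ, and_true, mem_inter_iff, mem_preimage, and_iff_left_iff_imp]
  intro h
  have := (extChartAt (𝓡 n) x).map_target h
  rwa [extChartAt_source] at this

theorem extChartAt_tangent_symm {x : M} {p : E n × E n}
    (hp : p.1 ∈ (extChartAt (𝓡 n) x).target) :
    (extChartAt (𝓡 n).tangent (⟨x, 0⟩ : TangentBundle (𝓡 n) M)).symm p =
      ⟨(extChartAt (𝓡 n) x).symm p.1, (trivializationAt (E n) (TangentSpace (𝓡 n) : M → Type _)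
        x).symmL ℝ ((extChartAt (𝓡 n) x).symm p.1) p.2⟩ := by
  have hb : (extChartAt (𝓡 n) x).symm p.1 ∈
      (trivializationAt (E n) (TangentSpace (𝓡 n) : M → Type _) x).baseSet := by
    have := (extChartAt (𝓡 n) x).map_target hp
    rwa [extChartAt_source] at this
  rw [FiberBundle.extChartAt, Trivialization.symmL_apply _ hb]
  exact ((trivializationAt (E n) (TangentSpace (𝓡 n) : M → Type _) x).mk_symm hb p.2).symm

theorem extChartAt_tangent_apply (x : M) (y : TangentSpace (𝓡 n) x) :
    extChartAt (𝓡 n).tangent (⟨x, 0⟩ : TangentBundle (𝓡 n) M) ⟨x, y⟩ = natCoord x y := by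
  rw [FiberBundle.extChartAt]
  refine Prod.ext rfl ?_
  exact (tangentBundleCore (𝓡 n) M).coordChange_self (achart (E n) x) x
    (mem_achart_source (E n) x) y

theorem coordRep_natCoord (G : TangentBundle (𝓡 n) M → ℝ) (x : M) (y : TangentSpace (𝓡 n) x) :
    coordRep G x (natCoord x y) = G ⟨x, y⟩ := by
  rw [coordRep, ← extChartAt_tangent_apply, (extChartAt _ _).left_inv]
  rw [extChartAt_source, TangentBundle.mem_chart_source_iff]
  exact mem_chart_source _ x

/-- The slit natural coordinate domain of the preferred chart at `x`. -/
def slitTarget (n : ℕ) {M : Type*} [TopologicalSpace M] [ChartedSpace (E n) M] (x : M) :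
    Set (E n × E n) :=
  (extChartAt (𝓡 n) x).target ×ˢ {y | y ≠ 0}

omit [IsManifold (𝓡 n) ∞ M] in
theorem isOpen_slitTarget (x : M) : IsOpen (slitTarget n x) :=
  (isOpen_extChartAt_target x).prod isOpen_ne

omit [IsManifold (𝓡 n) ∞ M] in
theorem smul_mem_slitTarget {x : M} {p : E n × E n} (hp : p ∈ slitTarget n x) {c : ℝ}
    (hc : c ≠ 0) : (p.1, c • p.2) ∈ slitTarget n x :=
  ⟨hp.1, smul_ne_zero hc hp.2⟩

omit [IsManifold (𝓡 n) ∞ M] in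
theorem natCoord_mem_slitTarget {x : M} {y : TangentSpace (𝓡 n) x} (hy : y ≠ 0) :
    natCoord x y ∈ slitTarget n x :=
  ⟨mem_extChartAt_target x, hy⟩

namespace FinslerStructure

variable (F : FinslerStructure n M)

theorem coordRep_smul {x : M} {p : E n × E n} (hp : p.1 ∈ (extChartAt (𝓡 n) x).target) {c : ℝ}
    (hc : 0 < c) : coordRep F.toFun x (p.1, c • p.2) = c * coordRep F.toFun x p := by
  rw [coordRep, coordRep, extChartAt_tangent_symm hp,
    extChartAt_tangent_symm (p := (p.1, c • p.2)) hp, ← F.homogeneous _ _ c hc, map_smul]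

theorem contDiffAt_coordRep {x : M} {p : E n × E n} (hp : p ∈ slitTarget n x) :
    ContDiffAt ℝ ∞ (coordRep F.toFun x) p := by
  have hT : p ∈ (extChartAt (𝓡 n).tangent (⟨x, 0⟩ : TangentBundle (𝓡 n) M)).target :=
    (mem_target_tangent x p).2 hp.1
  have hne : ((extChartAt (𝓡 n).tangent (⟨x, 0⟩ : TangentBundle (𝓡 n) M)).symm p).2 ≠ 0 := by
    rw [extChartAt_tangent_symm hp.1]
    have hb : (extChartAt (𝓡 n) x).symm p.1 ∈
        (trivializationAt (E n) (TangentSpace (𝓡 n) : M → Type _) x).baseSet := by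
      have := (extChartAt (𝓡 n) x).map_target hp.1
      rwa [extChartAt_source] at this
    intro h0
    have := (trivializationAt (E n) (TangentSpace (𝓡 n) : M → Type _)
      x).continuousLinearMapAt_symmL (R := ℝ) hb p.2
    rw [show (trivializationAt (E n) (TangentSpace (𝓡 n) : M → Type _) x).symmL ℝ _ p.2 = 0
      from h0, map_zero] at this
    exact hp.2 this.symm
  have h1 : ContMDiffAt (𝓡 n).tangent 𝓘(ℝ, ℝ) ∞ F.toFun
      ((extChartAt (𝓡 n).tangent (⟨x, 0⟩ : TangentBundle (𝓡 n) M)).symm p) :=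
    F.smooth.contMDiffAt ((Slit n M).isOpen.mem_nhds hne)
  have h2 : ContMDiffAt 𝓘(ℝ, E n × E n) (𝓡 n).tangent ∞
      (extChartAt (𝓡 n).tangent (⟨x, 0⟩ : TangentBundle (𝓡 n) M)).symm p :=
    (contMDiffOn_extChartAt_symm _).contMDiffAt ((isOpen_extChartAt_target _).mem_nhds hT)
  exact (h1.comp p h2).contDiffAt

theorem homogeneousOn (x : M) : HomogeneousOn (coordRep F.toFun x) (slitTarget n x) where
  isOpen := isOpen_slitTarget x
  smooth _ hp := F.contDiffAt_coordRep hp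
  euler _ hp := fderiv_euler (F.contDiffAt_coordRep hp).diffAt fun _ hc => F.coordRep_smul hp.1 hc

theorem pos {x : M} {y : TangentSpace (𝓡 n) x} (hy : y ≠ 0) : 0 < F.toFun ⟨x, y⟩ := by
  refine (F.nonneg _).lt_of_ne' fun h0 => ?_
  have h1 := (F.homogeneousOn x).sum_fundTensor_mul_mul (natCoord_mem_slitTarget hy)
  rw [coordRep_natCoord, h0] at h1
  have h2 := (F.convex x y hy).dotProduct_mulVec_pos (x := WithLp.ofLp (comps x y)) (by
    intro h; exact hy ((WithLp.ofLp_injective 2) h))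
  refine h2.ne' (Eq.trans ?_ (h1.trans (by norm_num)))
  simp only [dotProduct, Matrix.mulVec, natCoord, comps, star_trivial]
  exact Finset.sum_congr rfl fun i _ => congrArg _ (Finset.sum_congr rfl fun j _ => mul_comm _ _)

theorem det_pos {x : M} {y : TangentSpace (𝓡 n) x} (hy : y ≠ 0) :
    0 < (fundTensor (coordRep F.toFun x) (natCoord x y)).det :=
  (F.convex x y hy).det_pos

/-- The part of the slit natural coordinate domain at `x` where `F` and `det g` do not vanish. -/
def regularSet (x : M) : Set (E n × E n) :=
  slitTarget n x ∩ {p | coordRep F.toFun x p * (fundTensor (coordRep F.toFun x) p).det ≠ 0}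

theorem regularOn (x : M) : RegularOn (coordRep F.toFun x) (F.regularSet x) where
  isOpen := by
    refine ContinuousOn.isOpen_inter_preimage (t := {a : ℝ | a ≠ 0}) (fun p hp => ?_)
      (isOpen_slitTarget x) isOpen_ne
    exact ((F.contDiffAt_coordRep hp).continuousAt.mul
      (contDiffAt_det fun i j =>
        contDiffAt_fundTensor (F.contDiffAt_coordRep hp) i j).continuousAt).continuousWithinAt
  smooth _ hp := F.contDiffAt_coordRep hp.1
  euler _ hp := (F.homogeneousOn x).euler _ hp.1
  ne_zero _ hp := left_ne_zero_of_mul hp.2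
  nondegenerate _ hp := isUnit_iff_ne_zero.2 (right_ne_zero_of_mul hp.2)

theorem natCoord_mem_regularSet {x : M} {y : TangentSpace (𝓡 n) x} (hy : y ≠ 0) :
    natCoord x y ∈ F.regularSet x := by
  refine ⟨natCoord_mem_slitTarget hy, mul_ne_zero ?_ (F.det_pos hy).ne'⟩
  rw [coordRep_natCoord]
  exact (F.pos hy).ne'

/-- If the Berwald coefficients at `x` do not depend on `y`, they are the Chern coefficients. -/
theorem chernCoeff_eq_of_berwaldCoeff_const {x : M} {c : Fin n → Fin n → Fin n → ℝ}
    (h : ∀ (i j k : Fin n) (y : TangentSpace (𝓡 n) x), y ≠ 0 →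
      berwaldCoeff (coordRep F.toFun x) i j k (natCoord x y) = c i j k)
    (i j k : Fin n) {y : TangentSpace (𝓡 n) x} (hy : y ≠ 0) :
    chernCoeff (coordRep F.toFun x) i j k (natCoord x y) = c i j k := by
  have hp := F.natCoord_mem_regularSet hy
  rw [(F.regularOn x).chernCoeff_eq_berwaldCoeff hp, h i j k y hy]
  exact fun i j k l => dY_eq_zero_of_const hy ((F.regularOn x).smooth_berwaldCoeff hp i j k).diffAt
    (h i j k) l

end FinslerStructure

end Structure

/-! ## The volume of the indicatrix -/

section Cone

variable {n : ℕ} {φ ρ : E n → ℝ}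

theorem isBounded_sublevel (hφ : ContinuousOn φ {0}ᶜ) (hpos : ∀ y, y ≠ 0 → 0 < φ y)
    (hhom : ∀ (c : ℝ) (y : E n), 0 < c → φ (c • y) = c * φ y) :
    Bornology.IsBounded {y | φ y ≤ 1} := by
  have hs : Metric.sphere (0 : E n) 1 ⊆ {0}ᶜ := fun y hy h => by
    rw [mem_singleton_iff.1 h] at hy; simp at hy
  obtain ⟨m, hm, hle⟩ := (isCompact_sphere (0 : E n) 1).exists_forall_le' (hφ.mono hs)
    (a := 0) fun y hy => hpos y (hs hy)
  refine (Metric.isBounded_closedBall (x := (0 : E n)) (r := m⁻¹)).subset fun y hy => ?_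
  rw [mem_closedBall_zero_iff]
  by_cases h : y = 0
  · simp [h, hm.le]
  have hn : 0 < ‖y‖ := norm_pos_iff.2 h
  have h1 := hle (‖y‖⁻¹ • y) (by simp [norm_smul, hn.ne'])
  rw [hhom _ _ (inv_pos.2 hn), inv_mul_eq_div, le_div_iff₀ hn] at h1
  rw [← one_div, le_div_iff₀ hm, mul_comm]
  exact h1.trans hy

theorem exists_bound (hρ : ContinuousOn ρ {0}ᶜ)
    (hhom : ∀ (c : ℝ) (y : E n), 0 < c → y ≠ 0 → ρ (c • y) = ρ y) : ∃ C, ∀ y, y ≠ 0 → ρ y ≤ C := by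
  have hs : Metric.sphere (0 : E n) 1 ⊆ {0}ᶜ := fun y hy h => by
    rw [mem_singleton_iff.1 h] at hy; simp at hy
  obtain ⟨C, hC⟩ := (isCompact_sphere (0 : E n) 1).bddAbove_image (hρ.mono hs)
  refine ⟨C, fun y hy => ?_⟩
  have hn : 0 < ‖y‖ := norm_pos_iff.2 hy
  rw [← hhom _ y (inv_pos.2 hn) hy]
  exact hC ⟨_, by simp [norm_smul, hn.ne'], rfl⟩

theorem measurable_of_continuousOn_compl_zero (hφ : ContinuousOn φ {0}ᶜ) : Measurable φ := by
  refine measurable_of_measurable_on_compl_finite {0} (finite_singleton _) ?_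
  exact (continuousOn_iff_continuous_domRestrict.1 hφ).measurable

theorem measurableSet_unitCone (hφ : Measurable φ) : MeasurableSet {y | 0 < φ y ∧ φ y ≤ 1} :=
  (measurableSet_lt measurable_const hφ).inter (measurableSet_le hφ measurable_const)

theorem withDensity_unitCone_lt_top (hφ : ContinuousOn φ {0}ᶜ) (hpos : ∀ y, y ≠ 0 → 0 < φ y)
    (hhom : ∀ (c : ℝ) (y : E n), 0 < c → φ (c • y) = c * φ y) (h0 : φ 0 = 0)
    (hρ : ContinuousOn ρ {0}ᶜ)
    (hρhom : ∀ (c : ℝ) (y : E n), 0 < c → y ≠ 0 → ρ (c • y) = ρ y) :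
    (volume.withDensity fun y => ENNReal.ofReal (ρ y)) {y | 0 < φ y ∧ φ y ≤ 1} < ⊤ := by
  have hm := measurableSet_unitCone (measurable_of_continuousOn_compl_zero hφ)
  obtain ⟨C, hC⟩ := exists_bound hρ hρhom
  rw [withDensity_apply _ hm]
  calc _ ≤ ∫⁻ _ in {y | 0 < φ y ∧ φ y ≤ 1}, ENNReal.ofReal C :=
        setLIntegral_mono measurable_const fun y hy => ENNReal.ofReal_le_ofReal
          (hC y fun h => by rw [h, mem_ofPred_eq, h0] at hy; exact lt_irrefl _ hy.1)
    _ < ⊤ := by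
        rw [setLIntegral_const]
        exact ENNReal.mul_lt_top ENNReal.ofReal_lt_top
          ((isBounded_sublevel hφ hpos hhom).subset fun _ (hy : _ ∧ _) => hy.2).measure_lt_top

theorem withDensity_unitCone_pos (hn : 0 < n) (hφ : ContinuousOn φ {0}ᶜ)
    (hpos : ∀ y, y ≠ 0 → 0 < φ y)
    (hhom : ∀ (c : ℝ) (y : E n), 0 < c → φ (c • y) = c * φ y)
    (hρ : ContinuousOn ρ {0}ᶜ) (hρpos : ∀ y, y ≠ 0 → 0 < ρ y) :
    0 < (volume.withDensity fun y => ENNReal.ofReal (ρ y)) {y | 0 < φ y ∧ φ y ≤ 1} := by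
  rw [pos_iff_ne_zero, Ne, withDensity_apply_eq_zero
    (measurable_of_continuousOn_compl_zero hρ).ennreal_ofReal]
  have hU : IsOpen ({0}ᶜ ∩ {y : E n | φ y < 1}) :=
    hφ.isOpen_inter_preimage isOpen_compl_singleton isOpen_Iio
  have hv : (stdVec ⟨0, hn⟩ : E n) ≠ 0 := by simp
  set v : E n := stdVec ⟨0, hn⟩
  have hc : 0 < (2 * φ v)⁻¹ := inv_pos.2 (mul_pos two_pos (hpos v hv))
  have hne : ({0}ᶜ ∩ {y : E n | φ y < 1}).Nonempty := by
    refine ⟨(2 * φ v)⁻¹ • v, smul_ne_zero hc.ne' hv, ?_⟩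
    have := (hpos v hv).ne'
    rw [mem_ofPred_eq, hhom _ _ hc]
    field_simp
    norm_num
  refine ((hU.measure_pos volume hne).trans_le (measure_mono fun y hy => ?_)).ne'
  exact ⟨(ENNReal.ofReal_pos.2 (hρpos y hy.1)).ne', hpos y hy.1, le_of_lt hy.2⟩

end Cone

section Structure

variable {n : ℕ} {M : Type*} [TopologicalSpace M] [ChartedSpace (E n) M] [IsManifold (𝓡 n) ∞ M]

namespace FinslerStructure

variable (F : FinslerStructure n M) (x : M)

omit [IsManifold (𝓡 n) ∞ M] in
theorem continuous_natCoord : Continuous fun y : E n => natCoord x (y : TangentSpace (𝓡 n) x) :=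
  continuous_const.prodMk continuous_id

theorem continuousOn_fibre : ContinuousOn (fun y : E n => F.toFun ⟨x, y⟩) {0}ᶜ := by
  intro y hy
  have h := (F.contDiffAt_coordRep (natCoord_mem_slitTarget (x := x) hy)).continuousAt.comp
    (f := fun y : E n => natCoord x (y : TangentSpace (𝓡 n) x)) (continuous_natCoord x).continuousAt
  refine ContinuousAt.continuousWithinAt (h.congr (Filter.Eventually.of_forall fun z => ?_))
  exact coordRep_natCoord F.toFun x z

theorem continuousOn_density : ContinuousOn
    (fun y : E n => √(fundTensor (coordRep F.toFun x) (natCoord x y)).det) {0}ᶜ := by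
  intro y hy
  have h := (contDiffAt_det fun i j => contDiffAt_fundTensor (F.contDiffAt_coordRep
    (natCoord_mem_slitTarget (x := x) hy)) i j).continuousAt.comp
      (f := fun y : E n => natCoord x (y : TangentSpace (𝓡 n) x))
      (continuous_natCoord x).continuousAt
  exact (Real.continuous_sqrt.continuousAt.comp h).continuousWithinAt

theorem toFun_zero : F.toFun ⟨x, 0⟩ = 0 := by
  have h := F.homogeneous x 0 2 two_pos
  rw [smul_zero] at h
  linarith

theorem fundTensor_natCoord_smul {c : ℝ} (hc : 0 < c) {y : E n} (hy : y ≠ 0) :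
    fundTensor (coordRep F.toFun x) (natCoord x (c • y : E n)) =
      fundTensor (coordRep F.toFun x) (natCoord x y) :=
  fundTensor_scale (isOpen_slitTarget x) (fun _ hp => F.contDiffAt_coordRep hp) hc.ne'
    (fun _ hp => smul_mem_slitTarget hp hc.ne') (fun _ hp => F.coordRep_smul hp.1 hc)
    (natCoord_mem_slitTarget hy)

theorem measurableSet_indicatrix : MeasurableSet (indicatrix F x) :=
  measurable_of_continuousOn_compl_zero (F.continuousOn_fibre x) (measurableSet_singleton 1)

theorem indicatrixVolume_univ : indicatrixVolume F x univ =
    n * fibreVolume F x {y | 0 < F.toFun ⟨x, y⟩ ∧ F.toFun ⟨x, y⟩ ≤ 1} := by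
  have hφ := measurable_of_continuousOn_compl_zero (F.continuousOn_fibre x)
  have hg : Measurable fun y : E n => (F.toFun ⟨x, y⟩)⁻¹ • y := hφ.inv.smul measurable_id
  rw [indicatrixVolume, (MeasurableEmbedding.subtype_coe (F.measurableSet_indicatrix x)).comap_apply,
    image_univ, Subtype.range_coe, Measure.smul_apply,
    Measure.map_apply hg (F.measurableSet_indicatrix x),
    Measure.restrict_apply (hg (F.measurableSet_indicatrix x)), smul_eq_mul]
  congr 2
  refine inter_eq_right.2 fun y hy => ?_
  change F.toFun ⟨x, (F.toFun ⟨x, y⟩)⁻¹ • y⟩ = 1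
  exact (F.homogeneous x y _ (inv_pos.2 hy.1)).trans (inv_mul_cancel₀ hy.1.ne')

theorem indicatrixVolume_univ_lt_top : indicatrixVolume F x univ < ⊤ := by
  rw [indicatrixVolume_univ]
  refine ENNReal.mul_lt_top (ENNReal.natCast_lt_top n) ?_
  exact withDensity_unitCone_lt_top (F.continuousOn_fibre x) (fun _ hy => F.pos hy)
    (fun c y hc => F.homogeneous x y c hc) (F.toFun_zero x) (F.continuousOn_density x)
    fun c y hc hy => by rw [F.fundTensor_natCoord_smul x hc hy]

theorem indicatrixVolume_univ_pos (hn : 0 < n) : 0 < indicatrixVolume F x univ := by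
  rw [indicatrixVolume_univ]
  refine ENNReal.mul_pos (Nat.cast_ne_zero.2 hn.ne') (ne_of_gt ?_)
  exact withDensity_unitCone_pos hn (F.continuousOn_fibre x) (fun _ hy => F.pos hy)
    (fun c y hc => F.homogeneous x y c hc) (F.continuousOn_density x)
    fun y hy => Real.sqrt_pos.2 (F.det_pos hy)

/-- The average over the indicatrix of a constant is that constant. -/
theorem average_indicatrix_const (hn : 0 < n) (c : E n) :
    ⨍ _, c ∂(indicatrixVolume F x) = c := by
  have : IsFiniteMeasure (indicatrixVolume F x) := ⟨F.indicatrixVolume_univ_lt_top x⟩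
  have : NeZero (indicatrixVolume F x) :=
    ⟨fun h => (F.indicatrixVolume_univ_pos x hn).ne' (by rw [h]; rfl)⟩
  exact average_const _ c

end FinslerStructure

end Structure

/-! ## Connections on `π*TM` given by coefficients -/

section Structure

variable {n : ℕ} {M : Type*} [TopologicalSpace M] [ChartedSpace (E n) M] [IsManifold (𝓡 n) ∞ M]

theorem coeffMap_stdVec (c : Fin n → Fin n → Fin n → ℝ) (i j k : Fin n) :
    coeffMap c (stdVec k) (stdVec j) i = c i j k := by
  simp [coeffMap]

theorem sum_smul_coeffMap_stdVec (c : Fin n → Fin n → Fin n → ℝ) (Y X : E n) :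
    ∑ k, Y k • coeffMap c (stdVec k) X = coeffMap c Y X := by
  ext i
  simp only [coeffMap, WithLp.ofLp_sum, Finset.sum_apply]
  simp [Finset.mul_sum]
  rw [Finset.sum_comm]
  exact Finset.sum_congr rfl fun j _ => Finset.sum_congr rfl fun k _ => by ring

theorem hasMFDerivAt_slitProj (u : Slit n M) :
    HasMFDerivAt (𝓡 n).tangent (𝓡 n) (slitProj n M) u
      (ContinuousLinearMap.fst ℝ (E n) (E n)) := by
  refine ⟨(slitProj n M).contMDiff.continuous.continuousAt, ?_⟩
  refine HasFDerivAt.hasFDerivWithinAt ?_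
  refine (ContinuousLinearMap.fst ℝ (E n) (E n)).hasFDerivAt.congr_of_eventuallyEq ?_
  filter_upwards [extChartAt_target_mem_nhds (I := (𝓡 n).tangent) u] with z hz
  exact congrArg Prod.fst ((extChartAt (𝓡 n).tangent u).right_inv hz)

theorem mfderiv_slitProj_apply (u : Slit n M) (X : TangentSpace (𝓡 n).tangent u) :
    mfderiv (𝓡 n).tangent (𝓡 n) (slitProj n M) u X = (X : E n × E n).1 := by
  rw [(hasMFDerivAt_slitProj u).mfderiv]
  rfl

/-- The components of the vector field `Y` in the preferred trivialization at `x₀`. -/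
def fieldComps (x₀ : M) (Y : ∀ x : M, TangentSpace (𝓡 n) x) (x : M) : E n :=
  (trivializationAt (E n) (TangentSpace (𝓡 n) : M → Type _) x₀ ⟨x, Y x⟩).2

theorem mvfderiv_pullSection {Y : ∀ x : M, TangentSpace (𝓡 n) x} {u : Slit n M}
    (hY : MDifferentiableAt (𝓡 n) 𝓘(ℝ, E n) (fieldComps u.1.1 Y) u.1.1)
    (X : TangentSpace (𝓡 n).tangent u) :
    (mvfderiv (𝓡 n).tangent
        (fun v => (trivializationAt (E n) (PullTM n M) u ⟨v, pullSection Y v⟩).2) u X : E n) =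
      mvfderiv (𝓡 n) (fieldComps u.1.1 Y) u.1.1 ((X : E n × E n).1 : E n) := by
  have h := mfderiv_comp_apply (I := (𝓡 n).tangent) (I' := 𝓡 n) (I'' := 𝓘(ℝ, E n))
    (f := slitProj n M) (g := fieldComps u.1.1 Y) u hY
    (hasMFDerivAt_slitProj u).mdifferentiableAt X
  exact h.trans (congrArg (mfderiv (𝓡 n) 𝓘(ℝ, E n) (fieldComps u.1.1 Y) u.1.1)
    (mfderiv_slitProj_apply u X))

theorem ofCoeff_pullSection (Γ : Slit n M → Fin n → Fin n → Fin n → ℝ)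
    {Y : ∀ x : M, TangentSpace (𝓡 n) x} {u : Slit n M}
    (hY : MDifferentiableAt (𝓡 n) 𝓘(ℝ, E n) (fieldComps u.1.1 Y) u.1.1)
    (X : TangentSpace (𝓡 n).tangent u) :
    (ofCoeff Γ (pullSection Y) u X : E n) =
      (mvfderiv (𝓡 n) (fieldComps u.1.1 Y) u.1.1 ((X : E n × E n).1 : E n) : E n) +
        coeffMap (Γ u) (comps u.1.1 (Y u.1.1)) (X : E n × E n).1 :=
  congrArg₂ (fun a b : E n => a + b) (mvfderiv_pullSection hY X)
    (congrArg (coeffMap (Γ u) (comps u.1.1 (Y u.1.1))) (mfderiv_slitProj_apply u X))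

theorem fieldComps_constField (x : M) (c : E n) :
    fieldComps x (constField x c) =ᶠ[𝓝 x] fun _ => c := by
  filter_upwards [(trivializationAt (E n) (TangentSpace (𝓡 n) : M → Type _)
    x).open_baseSet.mem_nhds (mem_baseSet_trivializationAt _ _ _)] with z hz
  exact congrArg Prod.snd (Trivialization.apply_mk_symm _ hz c)

theorem comps_constField_self (x : M) (c : E n) : comps x (constField x c x) = c := by
  refine Eq.trans ?_ (fieldComps_constField x c).self_of_nhds
  exact ((tangentBundleCore (𝓡 n) M).coordChange_self (achart (E n) x) x
    (mem_achart_source (E n) x) _).symm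

theorem mdifferentiableAt_constField (x : M) (c : E n) :
    MDifferentiableAt (𝓡 n) 𝓘(ℝ, E n) (fieldComps x (constField x c)) x :=
  mdifferentiableAt_const.congr_of_eventuallyEq (fieldComps_constField x c)

theorem mvfderiv_constField (x : M) (c : E n) (X : TangentSpace (𝓡 n) x) :
    mvfderiv (𝓡 n) (fieldComps x (constField x c)) x X = 0 := by
  have h := (fieldComps_constField x c).mfderiv_eq (I := 𝓡 n) (I' := 𝓘(ℝ, E n))
  rw [mfderiv_const] at h
  exact congrArg (fun L : TangentSpace (𝓡 n) x →L[ℝ] E n => L X) h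

theorem ofCoeff_constField (Γ : Slit n M → Fin n → Fin n → Fin n → ℝ) (u : Slit n M) (c : E n)
    (X : TangentSpace (𝓡 n).tangent u) :
    (ofCoeff Γ (pullSection (constField u.1.1 c)) u X : E n) =
      coeffMap (Γ u) c (X : E n × E n).1 := by
  refine (ofCoeff_pullSection Γ (mdifferentiableAt_constField u.1.1 c) X).trans ?_
  refine (congrArg₂ (fun a b : E n => a + b) (mvfderiv_constField u.1.1 c _)
    (congrArg (fun w => coeffMap (Γ u) w _) (comps_constField_self u.1.1 c))).trans ?_
  exact zero_add _

theorem averagedConnection_constField (F : FinslerStructure n M)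
    (Γ : Slit n M → Fin n → Fin n → Fin n → ℝ) (x : M) (c : E n) (X : TangentSpace (𝓡 n) x) :
    (averagedConnection F (ofCoeff Γ) (constField x c) x X : E n) =
      ⨍ y, coeffMap (Γ (indicatrixPoint F x y)) c (comps x X) ∂(indicatrixVolume F x) := by
  unfold averagedConnection
  congr 1
  funext y
  exact ofCoeff_constField Γ (indicatrixPoint F x y) c _

theorem pullbackConnection_constField
    (D : (∀ x : M, TangentSpace (𝓡 n) x) → ∀ x : M, TangentSpace (𝓡 n) x → TangentSpace (𝓡 n) x)
    (u : Slit n M) (k : Fin n) (X : TangentSpace (𝓡 n).tangent u) :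
    (pullbackConnection D (pullSection (constField u.1.1 (stdVec k))) u X : E n) =
      comps u.1.1 (D (constField u.1.1 (stdVec k)) u.1.1 ((X : E n × E n).1 : E n)) := by
  have e1 : (mvfderiv (𝓡 n).tangent (fun v => (trivializationAt (E n) (PullTM n M) u
      ⟨v, pullSection (constField u.1.1 (stdVec k)) v⟩).2) u X : E n) = 0 :=
    (mvfderiv_pullSection (mdifferentiableAt_constField u.1.1 (stdVec k)) X).trans
      (mvfderiv_constField u.1.1 (stdVec k) _)
  have e2 : comps u.1.1 (pullSection (constField u.1.1 (stdVec k)) u) = stdVec k :=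
    comps_constField_self u.1.1 (stdVec k)
  have e3 : ∀ (w : E n) (Z : Fin n → E n), w = stdVec k → ∑ l, w l • Z l = Z k := by
    rintro _ Z rfl
    simp
  have e4 := e3 _ (fun l => comps u.1.1 (D (constField u.1.1 (stdVec l)) u.1.1
    (mfderiv (𝓡 n).tangent (𝓡 n) (slitProj n M) u X))) e2
  have e5 : comps u.1.1 (D (constField u.1.1 (stdVec k)) u.1.1
      (mfderiv (𝓡 n).tangent (𝓡 n) (slitProj n M) u X)) =
      comps u.1.1 (D (constField u.1.1 (stdVec k)) u.1.1 ((X : E n × E n).1 : E n)) :=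
    congrArg (fun v : E n => comps u.1.1 (D (constField u.1.1 (stdVec k)) u.1.1 v))
      (mfderiv_slitProj_apply u X)
  exact (congrArg₂ (fun a b : E n => a + b) e1 (e4.trans e5)).trans (zero_add _)

/-- The coefficients are constant along the fibres of `N → M`. -/
def FibrewiseConst (Γ : Slit n M → Fin n → Fin n → Fin n → ℝ) : Prop :=
  ∀ u v : Slit n M, u.1.1 = v.1.1 → Γ u = Γ v

theorem pos_dim (u : Slit n M) : 0 < n := by
  refine Nat.pos_of_ne_zero fun h => u.2 ?_
  subst h
  exact Subsingleton.elim (α := E 0) _ _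

theorem sameConnection_of_fibrewiseConst (F : FinslerStructure n M)
    {Γ : Slit n M → Fin n → Fin n → Fin n → ℝ} (h : FibrewiseConst Γ) :
    SameConnection (pullbackConnection (averagedConnection F (ofCoeff Γ)))
      (fun S u X => ofCoeff Γ S u X) := by
  intro S u _ X
  have h1 : ∀ c : E n, (averagedConnection F (ofCoeff Γ) (constField u.1.1 c) u.1.1
      (mfderiv (𝓡 n).tangent (𝓡 n) (slitProj n M) u X) : E n) =
      coeffMap (Γ u) c (mfderiv (𝓡 n).tangent (𝓡 n) (slitProj n M) u X) := by
    intro c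
    refine (averagedConnection_constField F Γ u.1.1 c _).trans ?_
    simp only [fun y => h (indicatrixPoint F u.1.1 y) u rfl]
    exact F.average_indicatrix_const u.1.1 (pos_dim u) _
  refine congrArg (fun w : E n => _ + w) ?_
  refine Eq.trans ?_ (sum_smul_coeffMap_stdVec (Γ u) (comps u.1.1 (S u))
    (mfderiv (𝓡 n).tangent (𝓡 n) (slitProj n M) u X))
  exact Finset.sum_congr rfl fun k _ => congrArg (fun w : E n => _ • w) (h1 (stdVec k))

theorem fibrewiseConst_of_sameConnection (F : FinslerStructure n M)
    {Γ : Slit n M → Fin n → Fin n → Fin n → ℝ}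
    (h : SameConnection (pullbackConnection (averagedConnection F (ofCoeff Γ)))
      (fun S u X => ofCoeff Γ S u X)) : FibrewiseConst Γ := by
  have key : ∀ (u : Slit n M) (i j k : Fin n), Γ u i j k =
      (⨍ y, coeffMap (Γ (indicatrixPoint F u.1.1 y)) (stdVec k) (stdVec j)
        ∂(indicatrixVolume F u.1.1) : E n) i := by
    intro u i j k
    have hY := mdifferentiableAt_constField u.1.1 (stdVec k)
    have hS : MDifferentiableAt (𝓡 n).tangent ((𝓡 n).tangent.prod 𝓘(ℝ, E n))
        (fun v => (⟨v, pullSection (constField u.1.1 (stdVec k)) v⟩ :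
          TotalSpace (E n) (PullTM n M))) u := by
      rw [mdifferentiableAt_section]
      exact MDifferentiableAt.comp u (I' := 𝓡 n) (f := slitProj n M) hY
        (hasMFDerivAt_slitProj u).mdifferentiableAt
    have H := h _ u hS ((stdVec j, 0) : E n × E n)
    have h1 : (ofCoeff Γ (pullSection (constField u.1.1 (stdVec k))) u
        ((stdVec j, 0) : E n × E n) : E n) = coeffMap (Γ u) (stdVec k) (stdVec j) :=
      ofCoeff_constField Γ u (stdVec k) _
    have h2 := pullbackConnection_constField (averagedConnection F (ofCoeff Γ)) u k
      ((stdVec j, 0) : E n × E n)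
    have h3 := averagedConnection_constField F Γ u.1.1 (stdVec k) (stdVec j : E n)
    rw [← coeffMap_stdVec (Γ u) i j k]
    exact congrArg (fun w : E n => w i) (h1.symm.trans (H.symm.trans (h2.trans h3)))
  rintro ⟨⟨x, y⟩, hy⟩ ⟨⟨x', z⟩, hz⟩ hxx
  change x = x' at hxx
  subst hxx
  funext i j k
  rw [key, key]

end Structure

/-! ## Berwald structures in the preferred charts -/

section Structure

variable {n : ℕ} {M : Type*} [TopologicalSpace M] [ChartedSpace (E n) M] [IsManifold (𝓡 n) ∞ M]

theorem fieldComps_eq_mfderiv {x₀ x : M} (hx : x ∈ (chartAt (E n) x₀).source)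
    (Y : ∀ x : M, TangentSpace (𝓡 n) x) :
    fieldComps x₀ Y x = mfderiv (𝓡 n) 𝓘(ℝ, E n) (extChartAt (𝓡 n) x₀) x (Y x) := by
  have h := TangentBundle.continuousLinearMapAt_trivializationAt (I := 𝓡 n) hx
  refine Eq.trans ?_ (congrArg (fun L : TangentSpace (𝓡 n) x →L[ℝ] E n => L (Y x)) h)
  have hb : x ∈ (trivializationAt (E n) (TangentSpace (𝓡 n) : M → Type _) x₀).baseSet := hx
  exact (Trivialization.continuousLinearMapAt_apply_of_mem _ (R := ℝ) hb (Y x)).symm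

theorem mdifferentiableAt_coordField {e : OpenPartialHomeomorph M (E n)}
    (he : e ∈ IsManifold.maximalAtlas (𝓡 n) ∞ M) {x : M} (hx : x ∈ e.source) (k : Fin n) :
    MDifferentiableAt (𝓡 n) 𝓘(ℝ, E n) (fieldComps x (coordField e k)) x := by
  have hsymm : ∀ z ∈ e.source, ContMDiffAt 𝓘(ℝ, E n) (𝓡 n) ∞ e.symm (e z) := fun z hz =>
    (contMDiffOn_symm_of_mem_maximalAtlas he).contMDiffAt
      (e.open_target.mem_nhds (e.map_source hz))
  have hchart : ∀ z ∈ (chartAt (E n) x).source,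
      ContMDiffAt (𝓡 n) 𝓘(ℝ, E n) ∞ (extChartAt (𝓡 n) x) z := fun z hz =>
    contMDiffAt_extChartAt' hz
  have hcomp : ContDiffAt ℝ ∞ (extChartAt (𝓡 n) x ∘ e.symm) (e x) := by
    refine ContMDiffAt.contDiffAt (ContMDiffAt.comp (e x) ?_ (hsymm x hx))
    rw [e.left_inv hx]
    exact hchart x (mem_chart_source _ x)
  have heq : fieldComps x (coordField e k) =ᶠ[𝓝 x]
      (fun q => fderiv ℝ (extChartAt (𝓡 n) x ∘ e.symm) q (stdVec k)) ∘ e := by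
    filter_upwards [e.open_source.mem_nhds hx,
      (chartAt (E n) x).open_source.mem_nhds (mem_chart_source _ x)] with z hz hz'
    rw [fieldComps_eq_mfderiv hz']
    have h1 : MDifferentiableAt (𝓡 n) 𝓘(ℝ, E n) (extChartAt (𝓡 n) x) (e.symm (e z)) := by
      rw [e.left_inv hz]
      exact (hchart z hz').mdifferentiableAt (by simp)
    have h2 := mfderiv_comp_apply (e z) h1 ((hsymm z hz).mdifferentiableAt (by simp)) (stdVec k)
    rw [mfderiv_eq_fderiv] at h2
    refine Eq.trans ?_ h2.symm
    rw [e.left_inv hz]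
    rfl
  refine MDifferentiableAt.congr_of_eventuallyEq ?_ heq
  refine MDifferentiableAt.comp x (I' := 𝓘(ℝ, E n)) ?_
    ((contMDiffAt_of_mem_maximalAtlas he hx).mdifferentiableAt (by simp))
  exact (((hcomp.fderiv_right (m := ∞) (by simp)).clm_apply contDiffAt_const).differentiableAt
    (by simp)).mdifferentiableAt

theorem mfderiv_chartAt_self (x : M) (v : E n) :
    (mfderiv (𝓡 n) (𝓡 n) (chartAt (E n) x) x v : E n) = v :=
  congrArg (fun L : E n →L[ℝ] E n => L v) (mfderiv_extChartAt_self (I := 𝓡 n) (x := x))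

theorem coordField_chartAt_self (x : M) (k : Fin n) :
    (coordField (chartAt (E n) x) k x : E n) = stdVec k := by
  have h := (mdifferentiable_chart (I := 𝓡 n) x).symm_comp_deriv (mem_chart_source (E n) x)
  have h1 := congrArg (fun L : E n →L[ℝ] E n => L (stdVec k)) h
  refine Eq.trans ?_ h1
  exact congrArg (mfderiv (𝓡 n) (𝓡 n) (chartAt (E n) x).symm (chartAt (E n) x x))
    (mfderiv_chartAt_self x (stdVec k)).symm

theorem isBerwald_iff (F : FinslerStructure n M) :
    IsBerwald F ↔
      FibrewiseConst fun (u : Slit n M) i j k =>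
        chernCoeff (coordRep F.toFun u.1.1) i j k (slitCoord u) := by
  have key : ∀ e ∈ IsManifold.maximalAtlas (𝓡 n) ∞ M, ∀ (j k : Fin n) (u : Slit n M),
      u.1.1 ∈ e.source → (chernConnection F (pullSection (coordField e k)) u
        (horizontalLift F u (coordField e j u.1.1)) : E n) =
      (mvfderiv (𝓡 n) (fieldComps u.1.1 (coordField e k)) u.1.1 (coordField e j u.1.1) : E n) +
        coeffMap (fun i j k => chernCoeff (coordRep F.toFun u.1.1) i j k (slitCoord u))
          (coordField e k u.1.1) (coordField e j u.1.1) := fun e he j k u hu =>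
    ofCoeff_pullSection _ (mdifferentiableAt_coordField he hu k) _
  constructor
  · rintro h ⟨⟨x, y⟩, hy⟩ ⟨⟨x', z⟩, hz⟩ hxx
    change x = x' at hxx
    subst hxx
    funext i j k
    have he : chartAt (E n) x ∈ IsManifold.maximalAtlas (𝓡 n) ∞ M :=
      IsManifold.chart_mem_maximalAtlas x
    have hx := mem_chart_source (E n) x
    have hval : ∀ (w : TangentSpace (𝓡 n) x) (hw : w ≠ 0),
        connCoeff F (chernConnection F) (chartAt (E n) x) i j k ⟨⟨x, w⟩, hw⟩ =
          (mvfderiv (𝓡 n) (fieldComps x (coordField (chartAt (E n) x) k)) x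
            (coordField (chartAt (E n) x) j x) : E n) i +
              chernCoeff (coordRep F.toFun x) i j k (natCoord x w) := by
      intro w hw
      have e1 := (mfderiv_chartAt_self x _).trans (key _ he j k ⟨⟨x, w⟩, hw⟩ hx)
      refine (congrArg (fun v : E n => v i) e1).trans (congrArg (fun a : ℝ => _ + a) ?_)
      refine Eq.trans ?_ (coeffMap_stdVec
        (fun i j k => chernCoeff (coordRep F.toFun x) i j k (natCoord x w)) i j k)
      exact congrArg₂ (fun a b : E n => coeffMap
        (fun i j k => chernCoeff (coordRep F.toFun x) i j k (natCoord x w)) a b i)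
        (coordField_chartAt_self x k) (coordField_chartAt_self x j)
    have H := h _ he i j k ⟨⟨x, y⟩, hy⟩ ⟨⟨x, z⟩, hz⟩ hx rfl
    exact add_left_cancel ((hval y hy).symm.trans (H.trans (hval z hz)))
  · rintro h e he i j k ⟨⟨x, y⟩, hy⟩ ⟨⟨x', z⟩, hz⟩ hx hxx
    change x = x' at hxx
    subst hxx
    have H := h ⟨⟨x, y⟩, hy⟩ ⟨⟨x, z⟩, hz⟩ rfl
    refine congrArg (fun w : E n => comps (M := E n) (e x) (mfderiv (𝓡 n) (𝓡 n) e x w) i) ?_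
    refine (key e he j k ⟨⟨x, y⟩, hy⟩ hx).trans
      (Eq.trans ?_ (key e he j k ⟨⟨x, z⟩, hz⟩ hx).symm)
    exact congrArg (fun c => _ + coeffMap c (coordField e k x) (coordField e j x)) H

end Structure

end Finsler

end

theorem proposition3p4 {n : ℕ} {M : Type*} [TopologicalSpace M] [ChartedSpace (Finsler.E n) M]
    [IsManifold (𝓡 n) ∞ M] (F : Finsler.FinslerStructure n M) :
    (Finsler.IsBerwald F ↔
      Finsler.SameConnection
        (Finsler.pullbackConnection (Finsler.averagedConnection F (Finsler.chernConnection F)))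
        (fun S u X => Finsler.chernConnection F S u X)) ∧
    (Finsler.SameConnection
        (Finsler.pullbackConnection (Finsler.averagedConnection F (Finsler.berwaldConnection F)))
        (fun S u X => Finsler.berwaldConnection F S u X) →
      Finsler.IsBerwald F) := by
  rw [Finsler.isBerwald_iff]
  refine ⟨⟨Finsler.sameConnection_of_fibrewiseConst F, Finsler.fibrewiseConst_of_sameConnection F⟩,
    fun h => ?_⟩
  have hb := Finsler.fibrewiseConst_of_sameConnection F h
  rintro ⟨⟨x, y⟩, hy⟩ ⟨⟨x', z⟩, hz⟩ hxx
  change x = x' at hxx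
  subst hxx
  have hc : ∀ (i j k : Fin n) (w : TangentSpace (𝓡 n) x), w ≠ 0 →
      Finsler.berwaldCoeff (Finsler.coordRep F.toFun x) i j k (Finsler.natCoord x w) =
        Finsler.berwaldCoeff (Finsler.coordRep F.toFun x) i j k (Finsler.natCoord x y) :=
    fun i j k w hw => congrFun (congrFun (congrFun (hb ⟨⟨x, w⟩, hw⟩ ⟨⟨x, y⟩, hy⟩ rfl) i) j) k
  funext i j k
  exact (F.chernCoeff_eq_of_berwaldCoeff_const hc i j k hy).trans
    (F.chernCoeff_eq_of_berwaldCoeff_const hc i j k hz).symm
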